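/- Let $1\le d\le n$ and let $M\subset\mathbb R^n$ be an (embedded) $C^2$ submanifold of dimension $d$ with $0\in M$. Denote by $T$ the orthogonal projector onto the tangent space $T_0M$, by $S=S_y$ the orthogonal projector onto $T_yM$ for $y\in M$, and put $T^\perp=\mathrm{Id}-T$, $S^\perp=\mathrm{Id}-S$. Let $H(0,M)$ be the mean curvature vector of $M$ at $0$, that is, the trace of the second fundamental form of $M$ at $0$. Let $\rho,\xi:[0,\infty)\to[0,\infty)$ be smooth functions supported on $[0,1]$ and not identically zero, and let $$C_\rho=d\,\omega_d\int_0^1\rho(t)t^{d-1}\,dt,\qquad C_\xi=d\,\omega_d\int_0^1\xi(t)t^{d-1}\,dt,$$ where $\omega_d$ is the volume of the unit ball of $\mathbb R^d$. For $\varepsilon>0$ and a family $\Pi=(\Pi_y)_{y\in M}$ of linear operators on $\mathbb R^n$ let $$H_\varepsilon^\Pi=-\frac{C_\xi}{C_\rho\,\varepsilon}\;\frac{\displaystyle\int_M\rho'\!\left(\frac{|y|}{\varepsilon}\right)\Pi_y\!\left(\frac{y}{|y|}\right)d\mathcal H^d(y)}{\displaystyle\int_M\xi\!\left(\frac{|y|}{\varepsilon}\right)d\mathcal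 H^d(y)} .$$ Then for all sufficiently small $\varepsilon>0$ the denominator is positive and the integral in the numerator exists for each $\Pi$ listed below, and $$\lim_{\varepsilon\to0^+}H_\varepsilon^\Pi=H(0,M)\quad\text{for }\Pi\in\{\,2S^\perp\circ T^\perp,\;S\circ T,\;-S^\perp\circ T\,\},$$ $$\lim_{\varepsilon\to0^+}H_\varepsilon^\Pi=0\quad\text{for }\Pi\in\{\,T,\;T\circ S,\;S\circ T^\perp,\;T\circ S^\perp\,\}.$$ -/

import Mathlib

open Set Filter MeasureTheory
open scoped Topology ContDiff

noncomputable section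

/-- `M` is an (embedded) `C²` submanifold of dimension `d` of `ℝⁿ`: near each of its points, a `C²`
diffeomorphism `Φ` between open subsets of `ℝⁿ` straightens `M` to a `d`-dimensional linear
subspace. -/
def IsC2Submanifold {n : ℕ} (d : ℕ) (M : Set (EuclideanSpace ℝ (Fin n))) : Prop :=
  ∀ x ∈ M, ∃ (Φ : OpenPartialHomeomorph (EuclideanSpace ℝ (Fin n)) (EuclideanSpace ℝ (Fin n)))
    (L : Submodule ℝ (EuclideanSpace ℝ (Fin n))),
    x ∈ Φ.source ∧ ContDiffOn ℝ 2 Φ Φ.source ∧ ContDiffOn ℝ 2 Φ.symm Φ.target ∧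
    Module.finrank ℝ L = d ∧ ∀ y ∈ Φ.source, (y ∈ M ↔ Φ y ∈ L)

/-- The tangent space of `M` at `x`: the span of the limits of `cₖ (yₖ - x)` with `yₖ ∈ M`,
`yₖ → x` and `cₖ ∈ ℝ`. -/
def tanSpace {n : ℕ} (M : Set (EuclideanSpace ℝ (Fin n))) (x : EuclideanSpace ℝ (Fin n)) :
    Submodule ℝ (EuclideanSpace ℝ (Fin n)) :=
  Submodule.span ℝ (tangentConeAt ℝ M x)

/-- The orthogonal projector of `ℝⁿ` onto the tangent space of `M` at `x`. -/
def tanProj {n : ℕ} (M : Set (EuclideanSpace ℝ (Fin n))) (x : EuclideanSpace ℝ (Fin n)) :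
    EuclideanSpace ℝ (Fin n) →L[ℝ] EuclideanSpace ℝ (Fin n) :=
  (tanSpace M x).starProjection

/-- The orthogonal projector of `ℝⁿ` onto the normal space of `M` at `x`. -/
def norProj {n : ℕ} (M : Set (EuclideanSpace ℝ (Fin n))) (x : EuclideanSpace ℝ (Fin n)) :
    EuclideanSpace ℝ (Fin n) →L[ℝ] EuclideanSpace ℝ (Fin n) :=
  (tanSpace M x)ᗮ.starProjection

/-- The second fundamental form `B(u, v) = (D_u V)^⊥` of `M` at `x`, for `u`, `v` tangent to `M` at
`x`, where `V` is the tangent vector field `y ↦ tanProj M y v` on `M`, which extends `v`. A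
derivative within `M` is determined in the directions tangent to `M`. -/
def secondFundForm {n : ℕ} (M : Set (EuclideanSpace ℝ (Fin n)))
    (x u v : EuclideanSpace ℝ (Fin n)) : EuclideanSpace ℝ (Fin n) :=
  norProj M x (fderivWithin ℝ (fun y => tanProj M y v) M x u)

/-- The mean curvature vector of `M` at `x`: the trace of the second fundamental form. -/
def meanCurvature {n : ℕ} (M : Set (EuclideanSpace ℝ (Fin n))) (x : EuclideanSpace ℝ (Fin n)) :
    EuclideanSpace ℝ (Fin n) :=
  ∑ i, secondFundForm M x (stdOrthonormalBasis ℝ (tanSpace M x) i)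
    (stdOrthonormalBasis ℝ (tanSpace M x) i)

/-- Smooth non-negative functions on `ℝ⁺ = [0, ∞)`, supported on `[0, 1]` and not identically zero.
Values at negative arguments play no role. -/
structure IsKernel (ρ : ℝ → ℝ) : Prop where
  smooth : ContDiffOn ℝ ∞ ρ (Ici 0)
  nonneg : ∀ t, 0 ≤ t → 0 ≤ ρ t
  supported : ∀ t, 1 < t → ρ t = 0
  nontrivial : ∃ t, 0 ≤ t ∧ ρ t ≠ 0

/-- `C_ρ = d ω_d ∫₀¹ ρ(t) t^{d-1} dt`, with `ω_d` the volume of the unit ball of `ℝᵈ`. -/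
def kernelConst (d : ℕ) (ρ : ℝ → ℝ) : ℝ :=
  d * volume.real (Metric.ball (0 : EuclideanSpace ℝ (Fin d)) 1) *
    ∫ t in (0 : ℝ)..1, ρ t * t ^ (d - 1)

/-- The mollified mass `(ξ_ε ∗ μ)(x) = ε^{-d} ∫ ξ(|y - x| / ε) dμ(y)`. -/
def mollifiedMass {n : ℕ} (d : ℕ) (ξ : ℝ → ℝ) (μ : Measure (EuclideanSpace ℝ (Fin n)))
    (x : EuclideanSpace ℝ (Fin n)) (ε : ℝ) : ℝ :=
  (ε ^ d)⁻¹ * ∫ y, ξ (‖y - x‖ / ε) ∂μ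

/-- The integrand `ρ'(|y - x| / ε) Π_y((y - x) / |y - x|)`. -/
def curvatureIntegrand {n : ℕ} (ρ : ℝ → ℝ)
    (P : EuclideanSpace ℝ (Fin n) → EuclideanSpace ℝ (Fin n) →L[ℝ] EuclideanSpace ℝ (Fin n))
    (x : EuclideanSpace ℝ (Fin n)) (ε : ℝ) (y : EuclideanSpace ℝ (Fin n)) :
    EuclideanSpace ℝ (Fin n) :=
  derivWithin ρ (Ici 0) (‖y - x‖ / ε) • P y (‖y - x‖⁻¹ • (y - x))

/-- The approximate mean curvature
`H_ε^Π(x) = - C_ξ / (C_ρ ε) · ∫ ρ'(|y-x|/ε) Π_y((y-x)/|y-x|) dμ(y) / (ε^d (ξ_ε ∗ μ)(x))`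
of a `d`-varifold with weight measure `μ`. -/
def approxMeanCurvature {n : ℕ} (d : ℕ) (ρ ξ : ℝ → ℝ) (μ : Measure (EuclideanSpace ℝ (Fin n)))
    (P : EuclideanSpace ℝ (Fin n) → EuclideanSpace ℝ (Fin n) →L[ℝ] EuclideanSpace ℝ (Fin n))
    (x : EuclideanSpace ℝ (Fin n)) (ε : ℝ) : EuclideanSpace ℝ (Fin n) :=
  -(kernelConst d ξ / (kernelConst d ρ * ε)) •
    (ε ^ d * mollifiedMass d ξ μ x ε)⁻¹ • ∫ y, curvatureIntegrand ρ P x ε y ∂μ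

/-- The weight measure `ℋᵈ ⌞ M` of the varifold associated with a `d`-dimensional submanifold `M`;
`μHE[d]` is the `d`-dimensional Hausdorff measure with the Euclidean normalization. -/
def weightMeasure {n : ℕ} (d : ℕ) (M : Set (EuclideanSpace ℝ (Fin n))) :
    Measure (EuclideanSpace ℝ (Fin n)) :=
  (μHE[d] : Measure (EuclideanSpace ℝ (Fin n))).restrict M

end

/-! Let `T` and `S_y` be the orthogonal projectors onto the tangent spaces of `M` at `a` and at `y`.
Near `a`, the submanifold `M` is the graph `φ` of a map from its tangent space `T_a M` to the normal
space, and the second fundamental form `B` of `M` at `a` is the Hessian of `φ` at `0`. A Taylor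
expansion of `φ` and of `x ↦ S_{φ x}` shows that each operator `Π_y` of the theorem satisfies
`Π_{φ x} (φ x - a) = ℓ x + b(x, x) + o(|x|²)`, with `b = B` on the diagonal for the operators of the
first list and `b = 0` for the others. In the rescaled integral on `T_a M` the odd term `ℓ` vanishes
by symmetry and the quadratic term produces the trace of `b`; an integration by parts in the radial
variable shows that the moment of `ρ'` involved is `-C_ρ`.

No area formula is needed to move the integrals to `T_a M`: the orthogonal projection of the graph
to `T_a M` is `1`-Lipschitz and `φ` is `(1 + C ε²)`-Lipschitz on the ball of radius `ε`, so the two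
measures differ by a factor `1 + O(ε²)`. -/

section Derivatives

variable {E F : Type*} [NormedAddCommGroup E] [NormedSpace ℝ E]
  [NormedAddCommGroup F] [NormedSpace ℝ F]

lemma tangentConeAt_coe_submodule {L : Submodule ℝ E} (hL : IsClosed (L : Set E)) {x : E}
    (hx : x ∈ L) : tangentConeAt ℝ (L : Set E) x = L := by
  refine Subset.antisymm (fun v hv => ?_) fun v hv => ?_
  · obtain ⟨_, l, _, c, u, -, hu, hlim⟩ := exists_fun_of_mem_tangentConeAt hv
    exact hL.mem_of_tendsto hlim (hu.mono fun k hk =>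
      L.smul_mem _ ((L.add_mem_iff_right hx).1 hk))
  · simpa using mem_tangentConeAt_of_segment_subset (x := x) (y := x + v)
      (L.convex.segment_subset hx (L.add_mem hx hv))

lemma mapsTo_tangentConeAt_of_eventually_mem {f : E → F} {f' : E →L[ℝ] F} {s : Set E} {t : Set F}
    {x : E} (hf : HasFDerivWithinAt f f' s x) (hst : ∀ᶠ y in 𝓝[s] x, f y ∈ t) :
    MapsTo f' (tangentConeAt ℝ s x) (tangentConeAt ℝ t (f x)) := by
  intro v hv
  have hs : 𝓝[s ∩ f ⁻¹' t] x = 𝓝[s] x := nhdsWithin_inter_of_mem' hst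
  rw [← tangentConeAt_congr hs] at hv
  refine tangentConeAt_mono ?_ ((hf.mono inter_subset_left).mapsTo_tangent_cone hv)
  exact (image_mono inter_subset_right).trans (image_preimage_subset f t)

lemma exists_equiv_hasFDerivAt_openPartialHomeomorph (Φ : OpenPartialHomeomorph E F) {x : E}
    (hx : x ∈ Φ.source) (hΦ : DifferentiableAt ℝ Φ x)
    (hΦsymm : DifferentiableAt ℝ Φ.symm (Φ x)) :
    ∃ A : E ≃L[ℝ] F, HasFDerivAt Φ (A : E →L[ℝ] F) x ∧
      HasFDerivAt Φ.symm (A.symm : F →L[ℝ] E) (Φ x) := by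
  have left_inv : (fderiv ℝ Φ.symm (Φ x)).comp (fderiv ℝ Φ x) = ContinuousLinearMap.id ℝ E :=
    (hΦsymm.hasFDerivAt.comp x hΦ.hasFDerivAt).unique
      ((hasFDerivAt_id x).congr_of_eventuallyEq (Φ.eventually_left_inverse hx))
  have right_inv : (fderiv ℝ Φ x).comp (fderiv ℝ Φ.symm (Φ x)) = ContinuousLinearMap.id ℝ F := by
    have hΦ' : HasFDerivAt Φ (fderiv ℝ Φ x) (Φ.symm (Φ x)) := by
      rw [Φ.left_inv hx]; exact hΦ.hasFDerivAt
    exact (hΦ'.comp (Φ x) hΦsymm.hasFDerivAt).unique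
      ((hasFDerivAt_id (Φ x)).congr_of_eventuallyEq
        (Φ.eventually_right_inverse (Φ.map_source hx)))
  exact ⟨ContinuousLinearEquiv.equivOfInverse _ _ (DFunLike.congr_fun left_inv)
    (DFunLike.congr_fun right_inv), hΦ.hasFDerivAt, hΦsymm.hasFDerivAt⟩

end Derivatives

section Projector

variable {E F : Type*} [NormedAddCommGroup E] [InnerProductSpace ℝ E]
  [NormedAddCommGroup F] [InnerProductSpace ℝ F] [CompleteSpace F]

lemma isUnit_adjoint_comp_self [FiniteDimensional ℝ E] [CompleteSpace E] {W : E →L[ℝ] F}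
    (hW : Function.Injective W) : IsUnit (W.adjoint ∘L W) := by
  have hinj : Function.Injective (W.adjoint ∘L W) :=
    W.adjoint_comp_self_injective_iff.2 hW
  exact ContinuousLinearMap.isUnit_iff_bijective.2
    ⟨hinj, LinearMap.injective_iff_surjective.1 hinj⟩

lemma starProjection_range_eq [CompleteSpace E] {W : E →L[ℝ] F} [W.range.HasOrthogonalProjection]
    (hW : IsUnit (W.adjoint ∘L W)) :
    W.range.starProjection = W ∘L Ring.inverse (W.adjoint ∘L W) ∘L W.adjoint := by
  ext1 y
  refine Submodule.eq_starProjection_of_mem_of_inner_eq_zero ⟨_, rfl⟩ ?_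
  rintro _ ⟨v, rfl⟩
  have hcancel : W.adjoint (W (Ring.inverse (W.adjoint ∘L W) (W.adjoint y))) = W.adjoint y :=
    DFunLike.congr_fun (Ring.mul_inverse_cancel _ hW) (W.adjoint y)
  change inner ℝ (y - W (Ring.inverse (W.adjoint ∘L W) (W.adjoint y))) (W v) = 0
  rw [← ContinuousLinearMap.adjoint_inner_left, map_sub, hcancel, sub_self, inner_zero_left]

lemma contDiffAt_starProjection_range [FiniteDimensional ℝ E] {W₀ : E →L[ℝ] F}
    (hW₀ : Function.Injective W₀) {k : WithTop ℕ∞} :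
    ContDiffAt ℝ k (fun W : E →L[ℝ] F => W.range.starProjection) W₀ := by
  have : CompleteSpace E := FiniteDimensional.complete ℝ E
  have hadj : ContDiff ℝ k (fun W : E →L[ℝ] F => W.adjoint) :=
    (ContinuousLinearMap.adjoint (𝕜 := ℝ) (E := E) (F := F)).contDiff
  have hgram : ContDiff ℝ k (fun W : E →L[ℝ] F => W.adjoint ∘L W) := hadj.clm_comp contDiff_id
  obtain ⟨u, hu⟩ := isUnit_adjoint_comp_self hW₀
  have hinv : ContDiffAt ℝ k (fun W : E →L[ℝ] F => Ring.inverse (W.adjoint ∘L W)) W₀ :=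
    ContDiffAt.comp (g := Ring.inverse) W₀ (hu ▸ contDiffAt_ringInverse ℝ u) hgram.contDiffAt
  refine (contDiffAt_id.clm_comp (hinv.clm_comp hadj.contDiffAt)).congr_of_eventuallyEq ?_
  filter_upwards [hgram.continuous.continuousAt.eventually (hu ▸ Units.nhds u)] with W hW
  exact starProjection_range_eq hW

end Projector

section Taylor

variable {E F : Type*} [NormedAddCommGroup E] [NormedSpace ℝ E]
  [NormedAddCommGroup F] [NormedSpace ℝ F]

lemma isLittleO_clm_apply {α : Type*} {l : Filter α} {A : α → E →L[ℝ] F} {v : α → E}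
    {f g : α → ℝ} (hA : A =o[l] f) (hv : v =O[l] g) :
    (fun x => A x (v x)) =o[l] fun x => f x * g x :=
  (Asymptotics.IsBigO.of_norm_le fun x => (A x).le_opNorm (v x)).trans_isLittleO
    (hA.norm_left.mul_isBigO hv.norm_left)

lemma isBigO_clm_apply {α : Type*} {l : Filter α} {A : α → E →L[ℝ] F} {v : α → E}
    {f g : α → ℝ} (hA : A =O[l] f) (hv : v =O[l] g) :
    (fun x => A x (v x)) =O[l] fun x => f x * g x :=
  (Asymptotics.IsBigO.of_norm_le fun x => (A x).le_opNorm (v x)).trans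
    (hA.norm_left.mul hv.norm_left)

lemma isLittleO_norm_sq_norm {E : Type*} [NormedAddCommGroup E] :
    (fun x : E => ‖x‖ ^ 2) =o[𝓝 0] fun x => ‖x‖ := by
  simpa using (Asymptotics.isLittleO_norm_pow_id (E' := E) one_lt_two).norm_right

lemma isLittleO_norm_sq_of_fderiv {f : E → F} (hf : ∀ᶠ x in 𝓝 0, DifferentiableAt ℝ f x)
    (hf' : fderiv ℝ f =o[𝓝 0] fun x => x) :
    (fun x => f x - f 0) =o[𝓝 0] fun x => ‖x‖ ^ 2 := by
  refine Asymptotics.isLittleO_iff.2 fun c hc => ?_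
  obtain ⟨δ, hδ, hball⟩ := Metric.eventually_nhds_iff_ball.1
    (hf.and (Asymptotics.isLittleO_iff.1 hf' hc))
  filter_upwards [Metric.ball_mem_nhds 0 hδ] with x hx
  have hsub : Metric.closedBall 0 ‖x‖ ⊆ Metric.ball (0 : E) δ :=
    Metric.closedBall_subset_ball (mem_ball_zero_iff.1 hx)
  have hbound : ∀ z ∈ Metric.closedBall (0 : E) ‖x‖, ‖fderiv ℝ f z‖ ≤ c * ‖x‖ := fun z hz =>
    (hball z (hsub hz)).2.trans (by gcongr; exact mem_closedBall_zero_iff.1 hz)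
  have := (convex_closedBall (0 : E) ‖x‖).norm_image_sub_le_of_norm_fderiv_le
    (fun z hz => (hball z (hsub hz)).1) hbound (Metric.mem_closedBall_self (norm_nonneg x))
    (mem_closedBall_zero_iff.2 le_rfl)
  simpa [sq, mul_assoc] using this

lemma isLittleO_taylor_two {f : E → F} (hf : ContDiffAt ℝ 2 f 0) :
    (fun x => f x - f 0 - (fderiv ℝ f 0 x + (1 / 2 : ℝ) • fderiv ℝ (fderiv ℝ f) 0 x x))
      =o[𝓝 0] fun x => ‖x‖ ^ 2 := by
  set B := fderiv ℝ (fderiv ℝ f) 0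
  have hB' : HasFDerivAt (fderiv ℝ f) B 0 :=
    ((hf.fderiv_right (m := 1) (by norm_num)).differentiableAt one_ne_zero).hasFDerivAt
  have hsymm : ∀ x v, B v x = B x v := fun x v =>
    (hf.isSymmSndFDerivAt (by simp)) v x
  have hdiff : ∀ᶠ x in 𝓝 0, DifferentiableAt ℝ f x :=
    (hf.eventually (by simp)).mono fun _ hx => hx.differentiableAt two_ne_zero
  have hderiv : ∀ᶠ x in 𝓝 0, HasFDerivAt
      (fun x => f x - (fderiv ℝ f 0 x + (1 / 2 : ℝ) • B x x))
      (fderiv ℝ f x - fderiv ℝ f 0 - B (x - 0)) x := by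
    filter_upwards [hdiff] with x hx
    refine (hx.hasFDerivAt.sub ((fderiv ℝ f 0).hasFDerivAt.add
      ((B.hasFDerivAt.clm_apply (hasFDerivAt_id x)).const_smul (1 / 2 : ℝ)))).congr_fderiv ?_
    ext1 v
    have add_half : (2⁻¹ : ℝ) + 2⁻¹ = 1 := by norm_num
    simp [hsymm x v, ← add_smul, add_half, sub_sub]
  have hremainder := isLittleO_norm_sq_of_fderiv (hderiv.mono fun _ hx => hx.differentiableAt)
    (hB'.isLittleO.congr' (hderiv.mono fun _ hx => hx.fderiv.symm) (by simp))
  refine hremainder.congr_left fun x => ?_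
  simp only [map_zero, smul_zero, add_zero, sub_zero]
  abel

end Taylor

section QuadraticExpansion

variable {V E F : Type*} [NormedAddCommGroup V] [NormedSpace ℝ V] [NormedAddCommGroup E]
  [NormedSpace ℝ E] [NormedAddCommGroup F] [NormedSpace ℝ F]

/-- The germ at `0` of a continuous function `f` with `f x = ℓ x + b x x + o(‖x‖²)`. The bilinear
map `b` is not required to be symmetric. -/
structure HasQuadraticExpansion (f : V → E) (ℓ : V →L[ℝ] E) (b : V →L[ℝ] V →L[ℝ] E) :
    Prop where
  continuousAt : ∀ᶠ x in 𝓝 0, ContinuousAt f x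
  isLittleO : (fun x => f x - (ℓ x + b x x)) =o[𝓝 0] fun x => ‖x‖ ^ 2

namespace HasQuadraticExpansion

variable {f g : V → E} {ℓ ℓ' : V →L[ℝ] E} {b b' : V →L[ℝ] V →L[ℝ] E}

lemma of_eq (h : HasQuadraticExpansion f ℓ b) (hfg : ∀ x, g x = f x) (hℓ : ∀ x, ℓ' x = ℓ x)
    (hb : ∀ x, b' x x = b x x) : HasQuadraticExpansion g ℓ' b' := by
  obtain rfl : g = f := funext hfg
  exact ⟨h.continuousAt, h.isLittleO.congr_left fun x => by rw [hℓ, hb]⟩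

lemma sub (hf : HasQuadraticExpansion f ℓ b) (hg : HasQuadraticExpansion g ℓ' b') :
    HasQuadraticExpansion (fun x => f x - g x) (ℓ - ℓ') (b - b') where
  continuousAt := by
    filter_upwards [hf.continuousAt, hg.continuousAt] with x hfx hgx using hfx.sub hgx
  isLittleO := (hf.isLittleO.sub hg.isLittleO).congr_left fun x => by
    simp only [sub_apply]
    abel

lemma const_smul (hf : HasQuadraticExpansion f ℓ b) (c : ℝ) :
    HasQuadraticExpansion (fun x => c • f x) (c • ℓ) (c • b) where
  continuousAt := hf.continuousAt.mono fun _ hx => hx.const_smul c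
  isLittleO := (hf.isLittleO.const_smul_left c).congr_left fun x => by
    simp [smul_sub, smul_add]

lemma clm_comp (A : E →L[ℝ] F) (hf : HasQuadraticExpansion f ℓ b) :
    HasQuadraticExpansion (fun x => A (f x)) (A ∘L ℓ)
      (ContinuousLinearMap.compL ℝ V E F A ∘L b) where
  continuousAt := hf.continuousAt.mono fun _ hx => A.continuous.continuousAt.comp hx
  isLittleO := (A.isBigO_comp _ _).trans_isLittleO hf.isLittleO |>.congr_left fun x => by
    simp

lemma isBigO_sub_linear (hf : HasQuadraticExpansion f ℓ b) :
    (fun x => f x - ℓ x) =O[𝓝 0] fun x => ‖x‖ ^ 2 := by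
  have hb : (fun x => b x x) =O[𝓝 0] fun x => ‖x‖ ^ 2 :=
    (isBigO_clm_apply (b.isBigO_id _).norm_right
      (Asymptotics.isBigO_refl _ _).norm_right).congr_right fun x => (sq ‖x‖).symm
  exact (hf.isLittleO.isBigO.add hb).congr_left fun x => by abel

lemma isBigO (hf : HasQuadraticExpansion f ℓ b) : f =O[𝓝 0] fun x => ‖x‖ := by
  have hsq : (fun x : V => ‖x‖ ^ 2) =O[𝓝 0] fun x => ‖x‖ :=
    isLittleO_norm_sq_norm.isBigO
  exact ((hf.isBigO_sub_linear.trans hsq).add (ℓ.isBigO_id _).norm_right).congr_left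
    fun x => by abel

lemma clm_apply {Q : V → E →L[ℝ] F} {Q' : V →L[ℝ] E →L[ℝ] F} (hQ : HasFDerivAt Q Q' 0)
    (hQc : ∀ᶠ x in 𝓝 0, ContinuousAt Q x) (hf : HasQuadraticExpansion f ℓ b) :
    HasQuadraticExpansion (fun x => Q x (f x)) (Q 0 ∘L ℓ)
      (Q'.bilinearComp (.id ℝ V) ℓ + ContinuousLinearMap.compL ℝ V E F (Q 0) ∘L b) where
  continuousAt := by
    filter_upwards [hQc, hf.continuousAt] with x hQx hfx using hQx.clm_apply hfx
  isLittleO := by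
    have hQ_rem : (fun x => (Q x - Q 0 - Q' x) (f x)) =o[𝓝 0] fun x => ‖x‖ ^ 2 := by
      have hrem : (fun x => Q x - Q 0 - Q' x) =o[𝓝 0] fun x => ‖x‖ := by
        simpa using hQ.isLittleO.norm_right
      exact (isLittleO_clm_apply hrem hf.isBigO).congr_right fun x => (sq ‖x‖).symm
    have hQ'_rem : (fun x => Q' x (f x - ℓ x)) =o[𝓝 0] fun x => ‖x‖ ^ 2 := by
      have hsq : (fun x : V => ‖x‖ ^ 2) =o[𝓝 0] fun x => ‖x‖ :=
        isLittleO_norm_sq_norm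
      refine (isBigO_clm_apply (Q'.isBigO_id _).norm_right
        hf.isBigO_sub_linear).trans_isLittleO ?_
      exact ((Asymptotics.isBigO_refl _ _).mul_isLittleO hsq).congr_right fun x => (sq ‖x‖).symm
    have hf_rem := (hf.clm_comp (Q 0)).isLittleO
    refine ((hQ_rem.add hQ'_rem).add hf_rem).congr_left fun x => ?_
    simp only [sub_apply, add_apply, ContinuousLinearMap.comp_apply,
      ContinuousLinearMap.compL_apply, ContinuousLinearMap.bilinearComp_apply,
      ContinuousLinearMap.id_apply, map_sub]
    abel

end HasQuadraticExpansion

end QuadraticExpansion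

section MeasureComparison

variable {α G : Type*} [MeasurableSpace α] [NormedAddCommGroup G] [NormedSpace ℝ G]

lemma norm_integral_sub_integral_le_of_le_smul {μ ν : Measure α} [IsFiniteMeasure μ] {c : NNReal}
    (hμν : μ ≤ ν) (hνμ : ν ≤ c • μ) {f g : α → G} (hf : AEStronglyMeasurable f μ)
    (hg : AEStronglyMeasurable g μ) {δ A : ℝ} (hδ : 0 ≤ δ) (hA : 0 ≤ A)
    (hfg : ∀ᵐ x ∂μ, ‖f x - g x‖ ≤ δ) (hgA : ∀ᵐ x ∂μ, ‖g x‖ ≤ A) :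
    Integrable f ν ∧
      ‖∫ x, f x ∂ν - ∫ x, g x ∂μ‖ ≤ (δ * c + A * (c - 1)) * μ.real univ := by
  have hac : ν ≪ μ := Measure.absolutelyContinuous_of_le_smul hνμ
  have hac' : ν - μ ≪ μ := (Measure.sub_le.absolutelyContinuous).trans hac
  have := isFiniteMeasure_of_le _ hνμ
  have := isFiniteMeasure_of_le ν (Measure.sub_le (μ := ν) (ν := μ))
  have hsub_int : Integrable (f - g) ν := .of_bound ((hf.sub hg).mono_ac hac) δ (hac hfg)
  have hg_int : Integrable g ν := .of_bound (hg.mono_ac hac) A (hac hgA)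
  have hf_int : Integrable f ν := by simpa using hsub_int.add hg_int
  have hν_real : ν.real univ ≤ c * μ.real univ := by
    simpa [Measure.real] using ENNReal.toReal_mono (measure_ne_top (c • μ) univ) (hνμ univ)
  have hdiff_real : (ν - μ).real univ = ν.real univ - μ.real univ := by
    rw [Measure.real, Measure.sub_apply .univ hμν,
      ENNReal.toReal_sub_of_le (hμν _) (measure_ne_top _ _)]
    rfl
  have hg_split : ∫ x, g x ∂ν = ∫ x, g x ∂(ν - μ) + ∫ x, g x ∂μ := by
    rw [← integral_add_measure (hg_int.mono_measure Measure.sub_le)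
      (hg_int.mono_measure hμν), Measure.sub_add_cancel_of_le hμν]
  refine ⟨hf_int, ?_⟩
  calc ‖∫ x, f x ∂ν - ∫ x, g x ∂μ‖
      = ‖∫ x, (f - g) x ∂ν + ∫ x, g x ∂(ν - μ)‖ := by
        simp only [Pi.sub_apply, integral_sub hf_int hg_int, hg_split]
        congr 1
        abel
    _ ≤ δ * ν.real univ + A * (ν - μ).real univ :=
        norm_add_le_of_le (norm_integral_le_of_norm_le_const (hac hfg))
          (norm_integral_le_of_norm_le_const (hac' hgA))
    _ ≤ δ * (c * μ.real univ) + A * (c * μ.real univ - μ.real univ) := by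
        rw [hdiff_real]
        gcongr
    _ = (δ * c + A * (c - 1)) * μ.real univ := by ring

variable {X Y : Type*} [EMetricSpace X] [EMetricSpace Y] [MeasurableSpace X] [BorelSpace X]
  [MeasurableSpace Y] [BorelSpace Y]

lemma euclideanHausdorffMeasure_image_le {f : X → Y} {s : Set X} {K : NNReal}
    (hf : LipschitzOnWith K f s) (d : ℕ) : μHE[d] (f '' s) ≤ (K : ENNReal) ^ d * μHE[d] s := by
  have hle := hf.hausdorffMeasure_image_le (d := d) (Nat.cast_nonneg d)
  rw [ENNReal.rpow_natCast] at hle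
  simp only [Measure.euclideanHausdorffMeasure_def, Measure.smul_apply, ENNReal.smul_def,
    smul_eq_mul]
  rw [mul_left_comm]
  gcongr

variable {V E : Type*} [NormedAddCommGroup V] [InnerProductSpace ℝ V] [FiniteDimensional ℝ V]
  [MeasurableSpace V] [BorelSpace V] [MetricSpace E] [MeasurableSpace E] [BorelSpace E]
  {φ : V → E} {p : E → V} {s : Set V}

lemma volume_restrict_le_map_euclideanHausdorffMeasure (hp : LipschitzWith 1 p)
    (hpφ : ∀ x ∈ s, p (φ x) = x) :
    volume.restrict s ≤ ((μHE[Module.finrank ℝ V]).restrict (φ '' s)).map p := by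
  refine Measure.le_iff.2 fun A hA => ?_
  have hpA := hp.continuous.measurable hA
  rw [Measure.restrict_apply hA, Measure.map_apply hp.continuous.measurable hA,
    Measure.restrict_apply hpA, ← InnerProductSpace.euclideanHausdorffMeasure_eq_volume]
  calc μHE[Module.finrank ℝ V] (A ∩ s)
      ≤ μHE[Module.finrank ℝ V] (p '' (p ⁻¹' A ∩ φ '' s)) := measure_mono fun x ⟨hxA, hxs⟩ =>
        ⟨φ x, ⟨by rwa [mem_preimage, hpφ x hxs], mem_image_of_mem φ hxs⟩, hpφ x hxs⟩
    _ ≤ μHE[Module.finrank ℝ V] (p ⁻¹' A ∩ φ '' s) := by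
        simpa using euclideanHausdorffMeasure_image_le hp.lipschitzOnWith (Module.finrank ℝ V)

lemma map_euclideanHausdorffMeasure_le_smul_volume_restrict {K : NNReal} (hp : Measurable p)
    (hpφ : ∀ x ∈ s, p (φ x) = x) (hφ : LipschitzOnWith K φ s) :
    ((μHE[Module.finrank ℝ V]).restrict (φ '' s)).map p ≤
      K ^ Module.finrank ℝ V • volume.restrict s := by
  refine Measure.le_iff.2 fun A hA => ?_
  rw [Measure.map_apply hp hA, Measure.restrict_apply (hp hA), Measure.smul_apply,
    Measure.restrict_apply hA, ENNReal.smul_def, ENNReal.coe_pow, smul_eq_mul,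
    ← InnerProductSpace.euclideanHausdorffMeasure_eq_volume]
  refine (measure_mono ?_).trans
    (euclideanHausdorffMeasure_image_le (hφ.mono inter_subset_right) _)
  rintro _ ⟨hy, x, hxs, rfl⟩
  exact ⟨x, ⟨by rwa [mem_preimage, hpφ x hxs] at hy, hxs⟩, rfl⟩

lemma integrableOn_image_and_norm_sub_le {K : NNReal} (hs : IsCompact s)
    (hp : LipschitzWith 1 p) (hpφ : ∀ x ∈ s, p (φ x) = x) (hφ : LipschitzOnWith K φ s)
    {f : E → G} {g : V → G} (hf : AEStronglyMeasurable (f ∘ φ) (volume.restrict s))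
    (hg : AEStronglyMeasurable g (volume.restrict s)) {δ A : ℝ} (hδ : 0 ≤ δ) (hA : 0 ≤ A)
    (hfg : ∀ x ∈ s, ‖f (φ x) - g x‖ ≤ δ) (hgA : ∀ x ∈ s, ‖g x‖ ≤ A) :
    IntegrableOn f (φ '' s) μHE[Module.finrank ℝ V] ∧
      ‖∫ y in φ '' s, f y ∂μHE[Module.finrank ℝ V] - ∫ x in s, g x‖ ≤
        (δ * K ^ Module.finrank ℝ V + A * (K ^ Module.finrank ℝ V - 1)) * volume.real s := by
  set ν := ((μHE[Module.finrank ℝ V]).restrict (φ '' s)).map p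
  have hp_meas := hp.continuous.measurable
  have hνle := map_euclideanHausdorffMeasure_le_smul_volume_restrict hp_meas hpφ hφ
  have : Fact (volume s < ⊤) := ⟨hs.measure_lt_top⟩
  obtain ⟨hint, hle⟩ := norm_integral_sub_integral_le_of_le_smul
    (volume_restrict_le_map_euclideanHausdorffMeasure hp hpφ) hνle hf hg hδ hA
    (ae_restrict_of_forall_mem hs.measurableSet hfg)
    (ae_restrict_of_forall_mem hs.measurableSet hgA)
  have hf_ν : AEStronglyMeasurable (f ∘ φ) ν :=
    hf.mono_ac (Measure.absolutelyContinuous_of_le_smul hνle)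
  have hcongr : f ∘ φ ∘ p =ᵐ[(μHE[Module.finrank ℝ V]).restrict (φ '' s)] f := by
    refine ae_restrict_of_forall_mem
      (hs.image_of_continuousOn hφ.continuousOn).measurableSet ?_
    rintro _ ⟨x, hx, rfl⟩
    simp [hpφ x hx]
  have hintegral : ∫ x, f (φ x) ∂ν = ∫ y in φ '' s, f y ∂μHE[Module.finrank ℝ V] :=
    (integral_map hp_meas.aemeasurable hf_ν).trans (integral_congr_ae hcongr)
  refine ⟨((integrable_map_measure hf_ν hp_meas.aemeasurable).1 hint).congr hcongr, ?_⟩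
  simpa [← hintegral] using hle

end MeasureComparison

section RadialProfile

/-- Lipschitz functions on `[0, ∞)` supported on `[0, 1]`: the radial weights `w (|x| / ε)` built
from them are localized in the ball of radius `ε`. Values at negative arguments play no role. -/
structure IsRadialProfile (w : ℝ → ℝ) : Prop where
  exists_lipschitzOnWith : ∃ L, LipschitzOnWith L w (Ici 0)
  eq_zero : ∀ t, 1 < t → w t = 0

lemma exists_nnnorm_le_of_continuousOn_Ici {w : ℝ → ℝ} (hw : ContinuousOn w (Ici 0))
    (hw₁ : ∀ t, 1 < t → w t = 0) : ∃ K, ∀ t ∈ Ici (0 : ℝ), ‖w t‖₊ ≤ K := by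
  obtain ⟨K, hK⟩ := isCompact_Icc.exists_bound_of_continuousOn
    (hw.mono (Icc_subset_Ici_self : Icc (0 : ℝ) 1 ⊆ Ici 0))
  refine ⟨K.toNNReal, fun t ht => ?_⟩
  rcases le_or_gt t 1 with h | h
  · exact NNReal.le_toNNReal_of_coe_le (hK t ⟨ht, h⟩)
  · simp [hw₁ t h]

lemma derivWithin_Ici_eq_zero {w : ℝ → ℝ} (hw₁ : ∀ t, 1 < t → w t = 0) (t : ℝ) (ht : 1 < t) :
    derivWithin w (Ici 0) t = 0 := by
  have hloc : w =ᶠ[𝓝[Ici 0] t] fun _ => 0 :=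
    nhdsWithin_le_nhds (eventually_of_mem (Ioi_mem_nhds ht) hw₁)
  simp [hloc.derivWithin_eq (hw₁ t ht)]

lemma isRadialProfile_of_contDiffOn {w : ℝ → ℝ} (hw : ContDiffOn ℝ 1 w (Ici 0))
    (hw₁ : ∀ t, 1 < t → w t = 0) : IsRadialProfile w := by
  obtain ⟨L, hL⟩ := exists_nnnorm_le_of_continuousOn_Ici
    (hw.continuousOn_derivWithin (uniqueDiffOn_Ici 0) le_rfl) (derivWithin_Ici_eq_zero hw₁)
  exact ⟨⟨L, (convex_Ici 0).lipschitzOnWith_of_nnnorm_derivWithin_le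
    (hw.differentiableOn one_ne_zero) hL⟩, hw₁⟩

lemma isRadialProfile_derivWithin {ρ : ℝ → ℝ} (hρ : ContDiffOn ℝ 2 ρ (Ici 0))
    (hρ₁ : ∀ t, 1 < t → ρ t = 0) : IsRadialProfile (derivWithin ρ (Ici 0)) :=
  isRadialProfile_of_contDiffOn (hρ.derivWithin (uniqueDiffOn_Ici 0) (by norm_num))
    (derivWithin_Ici_eq_zero hρ₁)

namespace IsRadialProfile

variable {w : ℝ → ℝ}

lemma continuousOn (hw : IsRadialProfile w) : ContinuousOn w (Ici 0) :=
  hw.exists_lipschitzOnWith.choose_spec.continuousOn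

lemma continuous_comp_norm_div (hw : IsRadialProfile w) {E : Type*} [NormedAddCommGroup E] {ε : ℝ}
    (hε : 0 ≤ ε) : Continuous fun x : E => w (‖x‖ / ε) :=
  hw.continuousOn.comp_continuous (by fun_prop) fun x => div_nonneg (norm_nonneg x) hε

lemma comp_norm_div_eq_zero (hw : IsRadialProfile w) {E : Type*} [NormedAddCommGroup E] {ε : ℝ}
    (hε : 0 < ε) {x : E} (hx : ε < ‖x‖) : w (‖x‖ / ε) = 0 :=
  hw.eq_zero _ ((one_lt_div hε).2 hx)

lemma exists_norm_le (hw : IsRadialProfile w) : ∃ K, 0 ≤ K ∧ ∀ t, 0 ≤ t → ‖w t‖ ≤ K :=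
  let ⟨K, hK⟩ := exists_nnnorm_le_of_continuousOn_Ici hw.continuousOn hw.eq_zero
  ⟨K, K.2, hK⟩

lemma exists_norm_apply_div_sub_le (hw : IsRadialProfile w) (C : ℝ) :
    ∃ D, ∀ ε s t, 0 ≤ t → t ≤ s → s ≤ t + C * t ^ 3 → t ≤ ε →
      ‖w (s / ε) - w (t / ε)‖ ≤ D * t ^ 2 := by
  obtain ⟨L, hL⟩ := hw.exists_lipschitzOnWith
  refine ⟨L * C, fun ε s t ht hts hst htε => ?_⟩
  have hε : 0 ≤ ε := ht.trans htε
  have hdiv : (s - t) / ε ≤ C * t ^ 2 := by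
    rcases ht.eq_or_lt with rfl | ht'
    · simp [le_antisymm (by simpa using hst) hts]
    · have hC : 0 ≤ C := by
        by_contra! hC
        nlinarith [mul_neg_of_neg_of_pos hC (pow_pos ht' 3)]
      rw [div_le_iff₀ (ht'.trans_le htε)]
      calc s - t ≤ C * t ^ 2 * t := by linarith
        _ ≤ C * t ^ 2 * ε := by gcongr
  calc ‖w (s / ε) - w (t / ε)‖ ≤ L * ‖s / ε - t / ε‖ :=
        hL.norm_sub_le (div_nonneg (ht.trans hts) hε) (div_nonneg ht hε)
    _ = L * ((s - t) / ε) := by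
        rw [← sub_div, Real.norm_of_nonneg (div_nonneg (sub_nonneg.2 hts) hε)]
    _ ≤ L * C * t ^ 2 := by rw [mul_assoc]; gcongr

lemma exists_norm_div_sub_div_le (hw : IsRadialProfile w) (C : ℝ) :
    ∃ D, ∀ ε s t, 0 ≤ t → t ≤ s → s ≤ t + C * t ^ 3 → t ≤ ε →
      ‖w (s / ε) * s⁻¹ - w (t / ε) * t⁻¹‖ ≤ D * t := by
  obtain ⟨D, hD⟩ := hw.exists_norm_apply_div_sub_le C
  obtain ⟨K, hK₀, hK⟩ := hw.exists_norm_le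
  refine ⟨D + K * C, fun ε s t ht hts hst htε => ?_⟩
  rcases ht.eq_or_lt with rfl | ht'
  · simp [le_antisymm (by simpa using hst) hts]
  have hs : 0 < s := ht'.trans_le hts
  have hinv : ‖s⁻¹ - t⁻¹‖ ≤ C * t := by
    rw [inv_sub_inv hs.ne' ht'.ne', norm_div, norm_sub_rev,
      Real.norm_of_nonneg (sub_nonneg.2 hts), Real.norm_of_nonneg (by positivity),
      div_le_iff₀ (by positivity)]
    have hC : 0 ≤ C * t ^ 3 := by linarith
    calc s - t ≤ C * t ^ 3 := by linarith
      _ ≤ C * t ^ 3 * (s / t) := le_mul_of_one_le_right hC ((one_le_div ht').2 hts)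
      _ = C * t * (s * t) := by field_simp
  calc ‖w (s / ε) * s⁻¹ - w (t / ε) * t⁻¹‖
      = ‖(w (s / ε) - w (t / ε)) * s⁻¹ + w (t / ε) * (s⁻¹ - t⁻¹)‖ := by congr 1; ring
    _ ≤ D * t ^ 2 * t⁻¹ + K * (C * t) := by
        refine norm_add_le_of_le ?_ ?_
        · rw [norm_mul, norm_inv, Real.norm_of_nonneg hs.le]
          exact mul_le_mul (hD ε s t ht hts hst htε) (by gcongr) (by positivity)
            ((norm_nonneg _).trans (hD ε s t ht hts hst htε))
        · rw [norm_mul]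
          exact mul_le_mul (hK _ (div_nonneg ht (ht.trans htε))) hinv (norm_nonneg _) hK₀
    _ = (D + K * C) * t := by field_simp

end IsRadialProfile

lemma kernelConst_pos {d : ℕ} (hd : 1 ≤ d) {ρ : ℝ → ℝ} (hρ : ContinuousOn ρ (Ici 0))
    (hρ₀ : ∀ t, 0 ≤ t → 0 ≤ ρ t) (hρ₁ : ∀ t, 1 < t → ρ t = 0) (hne : ∃ t, 0 ≤ t ∧ ρ t ≠ 0) :
    0 < kernelConst d ρ := by
  have hball : 0 < volume.real (Metric.ball (0 : EuclideanSpace ℝ (Fin d)) 1) :=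
    ENNReal.toReal_pos (Metric.measure_ball_pos _ _ one_pos).ne' measure_ball_lt_top.ne
  refine mul_pos (mul_pos (by exact_mod_cast hd) hball)
    (intervalIntegral.integral_pos one_pos ?_ ?_ ?_)
  · exact (hρ.mono Icc_subset_Ici_self).mul (by fun_prop)
  · exact fun t ht => mul_nonneg (hρ₀ t ht.1.le) (pow_nonneg ht.1.le _)
  · -- The factor `t ^ (d - 1)` may vanish at `0`, so positivity is moved to a point to the right.
    obtain ⟨t, ht, hne⟩ := hne
    have hpos : ∀ᶠ s in 𝓝[>] t, 0 < ρ s :=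
      ((hρ t ht).mono fun s hs => ht.trans (le_of_lt hs)).eventually
        (lt_mem_nhds ((hρ₀ t ht).lt_of_ne' hne))
    obtain ⟨s, hs, hts⟩ := (hpos.and self_mem_nhdsWithin).exists
    have hs₀ : 0 < s := ht.trans_lt hts
    have hs₁ : s ≤ 1 := not_lt.1 fun h => hs.ne' (hρ₁ s h)
    exact ⟨s, ⟨hs₀.le, hs₁⟩, mul_pos hs (pow_pos hs₀ _)⟩

end RadialProfile

section RadialIntegral

open scoped RealInnerProductSpace

variable {V F : Type*} [NormedAddCommGroup V] [InnerProductSpace ℝ V] [FiniteDimensional ℝ V]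
  [MeasurableSpace V] [BorelSpace V] [NormedAddCommGroup F] [NormedSpace ℝ F]

lemma integral_comp_norm_eq_kernelConst [Nontrivial V] {w : ℝ → ℝ} (hw₁ : ∀ t, 1 < t → w t = 0) :
    ∫ x : V, w ‖x‖ = kernelConst (Module.finrank ℝ V) w := by
  have hball : volume.real (Metric.ball (0 : V) 1) =
      volume.real (Metric.ball (0 : EuclideanSpace ℝ (Fin (Module.finrank ℝ V))) 1) := by
    rw [Measure.real, Measure.real,
      ← ((stdOrthonormalBasis ℝ V).measurePreserving_repr).measure_preimage
        measurableSet_ball.nullMeasurableSet, LinearIsometryEquiv.preimage_ball, map_zero]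
  have hradial : ∫ t in Ioi (0 : ℝ), t ^ (Module.finrank ℝ V - 1) • w t =
      ∫ t in (0 : ℝ)..1, w t * t ^ (Module.finrank ℝ V - 1) := by
    rw [intervalIntegral.integral_of_le zero_le_one]
    simp only [smul_eq_mul, mul_comm (w _)]
    exact (setIntegral_eq_of_subset_of_forall_sdiff_eq_zero measurableSet_Ioi Ioc_subset_Ioi_self
      fun t ht => by rw [hw₁ t (not_le.1 fun h => ht.2 ⟨ht.1, h⟩), mul_zero])
  rw [integral_fun_norm_addHaar, hradial, hball, nsmul_eq_mul, smul_eq_mul, kernelConst,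
    mul_assoc]

lemma integral_comp_norm_div [Nontrivial V] {w : ℝ → ℝ} (hw₁ : ∀ t, 1 < t → w t = 0) {ε : ℝ}
    (hε : 0 ≤ ε) :
    ∫ x : V, w (‖x‖ / ε) = ε ^ Module.finrank ℝ V * kernelConst (Module.finrank ℝ V) w := by
  rw [← integral_comp_norm_eq_kernelConst hw₁, ← smul_eq_mul,
    ← Measure.integral_comp_inv_smul_of_nonneg volume (fun x : V => w ‖x‖) hε]
  simp only [norm_smul, norm_inv, Real.norm_of_nonneg hε, div_eq_inv_mul]

lemma kernelConst_derivWithin_mul_self {d : ℕ} (hd : d ≠ 0) {ρ : ℝ → ℝ}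
    (hρ : ContDiffOn ℝ 1 ρ (Ici 0)) (hρ₁ : ∀ t, 1 < t → ρ t = 0) :
    kernelConst d (fun t => derivWithin ρ (Ici 0) t * t) = -(d * kernelConst d ρ) := by
  have hsub : uIcc (0 : ℝ) 1 ⊆ Ici 0 := by
    rw [uIcc_of_le zero_le_one]
    exact Icc_subset_Ici_self
  have hρ_one : ρ 1 = 0 := by
    refine tendsto_nhds_unique (f := ρ) (l := 𝓝[>] 1)
      ((hρ.continuousOn 1 (zero_le_one' ℝ)).mono fun t ht =>
        (zero_le_one' ℝ).trans (le_of_lt ht)) ?_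
    exact tendsto_const_nhds.congr' (eventually_mem_nhdsWithin.mono fun t ht => (hρ₁ t ht).symm)
  have hparts : ∫ t in (0 : ℝ)..1, t ^ d * derivWithin ρ (Ici 0) t =
      -∫ t in (0 : ℝ)..1, d * t ^ (d - 1) * ρ t := by
    rw [intervalIntegral.integral_mul_deriv_eq_deriv_mul_of_hasDeriv_right
      (u' := fun t => d * t ^ (d - 1)) (by fun_prop) (hρ.continuousOn.mono hsub)
      (fun t _ => (hasDerivAt_pow d t).hasDerivWithinAt) (fun t ht => ?_)
      (Continuous.intervalIntegrable (by fun_prop) _ _)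
      ((hρ.continuousOn_derivWithin (uniqueDiffOn_Ici 0) le_rfl).mono hsub).intervalIntegrable]
    · simp [hρ_one, hd]
    · have ht₀ : 0 ≤ t := by simpa using ht.1.le
      exact (hρ.differentiableOn one_ne_zero t ht₀).hasDerivWithinAt.mono
        fun s hs => ht₀.trans (le_of_lt hs)
  have hpow : ∀ t : ℝ, derivWithin ρ (Ici 0) t * t * t ^ (d - 1) =
      t ^ d * derivWithin ρ (Ici 0) t := fun t => by
    rw [mul_assoc, mul_pow_sub_one hd, mul_comm]
  simp only [kernelConst, hpow, hparts, mul_assoc, intervalIntegral.integral_const_mul,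
    mul_comm (_ ^ _) (ρ _)]
  ring

lemma integral_eq_zero_of_odd {f : V → F} (hf : ∀ x, f (-x) = -f x) : ∫ x, f x = 0 := by
  have hneg := integral_neg_eq_self f volume
  simp only [hf, integral_neg] at hneg
  have : IsAddTorsionFree F := .of_isTorsionFree ℝ F
  exact neg_eq_self.1 hneg

lemma integral_comp_norm_mul_inner_mul_inner_of_orthogonal (u : ℝ → ℝ) {v v' : V}
    (h : ⟪v, v'⟫ = 0) : ∫ x : V, u ‖x‖ * (⟪v, x⟫ * ⟪v', x⟫) = 0 := by
  let R := (ℝ ∙ v)ᗮ.reflection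
  have hRv : ∀ x, ⟪v, R x⟫ = -⟪v, x⟫ := fun x => by
    rw [← R.inner_map_map v x, Submodule.reflection_orthogonalComplement_singleton_eq_neg,
      inner_neg_left, neg_neg]
  have hRv' : ∀ x, ⟪v', R x⟫ = ⟪v', x⟫ := fun x => by
    rw [← R.inner_map_map v' x, Submodule.reflection_mem_subspace_eq_self
      (Submodule.mem_orthogonal_singleton_iff_inner_right.2 h)]
  have hR := R.measurePreserving.integral_comp R.toHomeomorph.measurableEmbedding
    (fun x => u ‖x‖ * (⟪v, x⟫ * ⟪v', x⟫))
  simp only [R.norm_map, hRv, hRv', neg_mul, mul_neg, integral_neg] at hR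
  exact neg_eq_self.1 hR

lemma integral_comp_norm_mul_inner_sq_eq (u : ℝ → ℝ) {v v' : V} (h : ‖v‖ = ‖v'‖) :
    ∫ x : V, u ‖x‖ * (⟪v, x⟫ * ⟪v, x⟫) = ∫ x : V, u ‖x‖ * (⟪v', x⟫ * ⟪v', x⟫) := by
  let R := (ℝ ∙ (v - v'))ᗮ.reflection
  have hRv : ∀ x, ⟪v', R x⟫ = ⟪v, x⟫ := fun x => by
    rw [← R.inner_map_map v x, Submodule.reflection_sub h]
  have hR := R.measurePreserving.integral_comp R.toHomeomorph.measurableEmbedding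
    (fun x => u ‖x‖ * (⟪v', x⟫ * ⟪v', x⟫))
  simpa only [R.norm_map, hRv] using hR

lemma integrable_comp_norm_mul_inner_mul_inner {u : ℝ → ℝ}
    (hu : AEStronglyMeasurable fun x : V => u ‖x‖)
    (hint : Integrable fun x : V => u ‖x‖ * ‖x‖ ^ 2) (v v' : V) :
    Integrable fun x : V => u ‖x‖ * (⟪v, x⟫ * ⟪v', x⟫) := by
  refine (hint.const_mul (‖v‖ * ‖v'‖)).mono
    (hu.mul (Continuous.aestronglyMeasurable (by fun_prop))) (ae_of_all _ fun x => ?_)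
  simp only [norm_mul, norm_norm, norm_pow]
  calc ‖u ‖x‖‖ * (‖⟪v, x⟫‖ * ‖⟪v', x⟫‖) ≤ ‖u ‖x‖‖ * ((‖v‖ * ‖x‖) * (‖v'‖ * ‖x‖)) := by
        gcongr <;> exact norm_inner_le_norm _ _
    _ = ‖v‖ * ‖v'‖ * (‖u ‖x‖‖ * ‖x‖ ^ 2) := by ring

lemma integral_comp_norm_mul_inner_sq {ι : Type*} [Fintype ι] {u : ℝ → ℝ}
    (hu : AEStronglyMeasurable fun x : V => u ‖x‖)
    (hint : Integrable fun x : V => u ‖x‖ * ‖x‖ ^ 2) (e : OrthonormalBasis ι ℝ V) (i : ι) :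
    ∫ x : V, u ‖x‖ * (⟪e i, x⟫ * ⟪e i, x⟫) =
      (Fintype.card ι : ℝ)⁻¹ * ∫ x : V, u ‖x‖ * ‖x‖ ^ 2 := by
  have : Nonempty ι := ⟨i⟩
  have hsum : ∫ x : V, u ‖x‖ * ‖x‖ ^ 2 = ∑ j, ∫ x : V, u ‖x‖ * (⟪e j, x⟫ * ⟪e j, x⟫) := by
    rw [← integral_finsetSum _ fun j _ => integrable_comp_norm_mul_inner_mul_inner hu hint _ _]
    simp only [← e.sum_sq_norm_inner_right, Real.norm_eq_abs, sq_abs, Finset.mul_sum]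
    simp only [sq]
  simp [hsum, integral_comp_norm_mul_inner_sq_eq u ((e.norm_eq_one _).trans (e.norm_eq_one i).symm)]

lemma integral_comp_norm_smul_bilin [CompleteSpace F] {ι : Type*} [Fintype ι] {u : ℝ → ℝ}
    (hu : AEStronglyMeasurable fun x : V => u ‖x‖)
    (hint : Integrable fun x : V => u ‖x‖ * ‖x‖ ^ 2) (e : OrthonormalBasis ι ℝ V)
    (b : V →L[ℝ] V →L[ℝ] F) :
    ∫ x : V, u ‖x‖ • b x x =
      ((Fintype.card ι : ℝ)⁻¹ * ∫ x : V, u ‖x‖ * ‖x‖ ^ 2) • ∑ i, b (e i) (e i) := by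
  have hcoord := fun i j => integrable_comp_norm_mul_inner_mul_inner hu hint (e i) (e j)
  have hexpand : ∀ x, u ‖x‖ • b x x =
      ∑ i, ∑ j, (u ‖x‖ * (⟪e i, x⟫ * ⟪e j, x⟫)) • b (e i) (e j) := fun x => by
    have hx : b x x = ∑ i, ∑ j, (⟪e i, x⟫ * ⟪e j, x⟫) • b (e i) (e j) := by
      conv_lhs => rw [← e.sum_repr' x]
      simp only [map_sum, map_smul, sum_apply, smul_apply,
        Finset.smul_sum, smul_smul]
      rw [Finset.sum_comm]
      simp only [mul_comm]
    simp only [hx, Finset.smul_sum, mul_smul]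
  simp only [hexpand]
  rw [integral_finsetSum _ fun i _ => integrable_finsetSum _ fun j _ => (hcoord i j).smul_const _,
    Finset.smul_sum]
  refine Finset.sum_congr rfl fun i _ => ?_
  rw [integral_finsetSum _ fun j _ => (hcoord i j).smul_const _, Finset.sum_eq_single i]
  · rw [integral_smul_const, integral_comp_norm_mul_inner_sq hu hint e i]
  · intro j _ hj
    rw [integral_smul_const, integral_comp_norm_mul_inner_mul_inner_of_orthogonal u
      (e.inner_eq_zero hj.symm), zero_smul]
  · simp

end RadialIntegral

section ModelIntegrand

variable {V F : Type*} [NormedAddCommGroup V] [NormedSpace ℝ V] [NormedAddCommGroup F]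
  [NormedSpace ℝ F] {w : ℝ → ℝ} {ℓ : V →L[ℝ] F} {b : V →L[ℝ] V →L[ℝ] F} {ε : ℝ}

/-- The counterpart on the tangent space of `curvatureIntegrand`, in which the distance to the base
point is replaced with `‖x‖` and `y ↦ Π_y (y - a)` with its quadratic expansion `ℓ x + b x x`. -/
noncomputable def modelIntegrand (w : ℝ → ℝ) (ℓ : V →L[ℝ] F) (b : V →L[ℝ] V →L[ℝ] F) (ε : ℝ)
    (x : V) : F :=
  w (‖x‖ / ε) • ‖x‖⁻¹ • (ℓ x + b x x)

lemma norm_inv_smul_add_bilin_le (ℓ : V →L[ℝ] F) (b : V →L[ℝ] V →L[ℝ] F) (x : V) :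
    ‖‖x‖⁻¹ • (ℓ x + b x x)‖ ≤ ‖ℓ‖ + ‖b‖ * ‖x‖ := by
  rw [norm_smul, norm_inv, norm_norm]
  refine inv_mul_le_of_le_mul₀ (norm_nonneg x) (by positivity) ?_
  calc ‖ℓ x + b x x‖ ≤ ‖ℓ‖ * ‖x‖ + ‖b‖ * ‖x‖ * ‖x‖ :=
        norm_add_le_of_le (ℓ.le_opNorm x) (b.le_opNorm₂ x x)
    _ = ‖x‖ * (‖ℓ‖ + ‖b‖ * ‖x‖) := by ring

lemma exists_norm_modelIntegrand_le (hw : IsRadialProfile w) (ℓ : V →L[ℝ] F)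
    (b : V →L[ℝ] V →L[ℝ] F) :
    ∃ A, 0 ≤ A ∧ ∀ ε, 0 ≤ ε → ∀ x, ‖x‖ ≤ 1 → ‖modelIntegrand w ℓ b ε x‖ ≤ A := by
  obtain ⟨K, hK₀, hK⟩ := hw.exists_norm_le
  refine ⟨K * (‖ℓ‖ + ‖b‖), by positivity, fun ε hε x hx => ?_⟩
  rw [modelIntegrand, norm_smul]
  gcongr
  · exact hK _ (div_nonneg (norm_nonneg x) hε)
  · calc ‖‖x‖⁻¹ • (ℓ x + b x x)‖ ≤ ‖ℓ‖ + ‖b‖ * ‖x‖ := norm_inv_smul_add_bilin_le ℓ b x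
      _ ≤ ‖ℓ‖ + ‖b‖ := by gcongr; exact mul_le_of_le_one_right (norm_nonneg b) hx

lemma modelIntegrand_eq_zero (hw : IsRadialProfile w) (hε : 0 < ε) {x : V} (hx : ε < ‖x‖) :
    modelIntegrand w ℓ b ε x = 0 := by
  rw [modelIntegrand, hw.comp_norm_div_eq_zero hε hx, zero_smul]

lemma eventually_forall_closedBall {X : Type*} [PseudoMetricSpace X] {a : X} {p : X → Prop}
    (hp : ∀ᶠ x in 𝓝 a, p x) : ∀ᶠ ε in 𝓝 (0 : ℝ), ∀ x ∈ Metric.closedBall a ε, p x :=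
  (tendsto_closedBall_smallSets a).eventually hp.smallSets

lemma HasQuadraticExpansion.eventually_norm_sub_modelIntegrand_le {f : V → F}
    (hf : HasQuadraticExpansion f ℓ b) (hw : IsRadialProfile w) {σ : V → ℝ} {C : ℝ}
    (hσ : ∀ᶠ x in 𝓝 0, ‖x‖ ≤ σ x ∧ σ x ≤ ‖x‖ + C * ‖x‖ ^ 3) {c : ℝ} (hc : 0 < c) :
    ∀ᶠ ε in 𝓝[>] 0, ∀ x ∈ Metric.closedBall 0 ε,
      ‖w (σ x / ε) • (σ x)⁻¹ • f x - modelIntegrand w ℓ b ε x‖ ≤ c * ε := by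
  obtain ⟨K, _, hK⟩ := hw.exists_norm_le
  obtain ⟨D, hD⟩ := hw.exists_norm_div_sub_div_le C
  set q := fun x => ℓ x + b x x
  have hweight : (fun x => D * (‖x‖ * ‖f x‖)) =o[𝓝 0] fun x => ‖x‖ :=
    (((Asymptotics.isBigO_refl _ _).mul hf.isBigO.norm_left).trans_isLittleO
      (isLittleO_norm_sq_norm.congr_left fun x => sq ‖x‖)).const_mul_left D
  have hremainder : (fun x => K * (‖x‖⁻¹ * ‖f x - q x‖)) =o[𝓝 0] fun x => ‖x‖ :=
    (((Asymptotics.isBigO_refl (fun x : V => ‖x‖⁻¹) (𝓝 0)).mul_isLittleO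
      hf.isLittleO.norm_left).congr_right fun x => by
        rcases eq_or_ne ‖x‖ 0 with hx | hx
        · simp [hx]
        · field_simp).const_mul_left K
  filter_upwards [nhdsWithin_le_nhds
    (eventually_forall_closedBall (hσ.and ((hweight.add hremainder).def hc)))] with ε hε x hx
  obtain ⟨⟨hσ_ge, hσ_le⟩, hsmall⟩ := hε x hx
  have hxε : ‖x‖ ≤ ε := mem_closedBall_zero_iff.1 hx
  have hdecomp : w (σ x / ε) • (σ x)⁻¹ • f x - modelIntegrand w ℓ b ε x =
      (w (σ x / ε) * (σ x)⁻¹ - w (‖x‖ / ε) * ‖x‖⁻¹) • f x +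
        (w (‖x‖ / ε) * ‖x‖⁻¹) • (f x - q x) := by
    simp only [modelIntegrand, q]
    module
  calc ‖w (σ x / ε) • (σ x)⁻¹ • f x - modelIntegrand w ℓ b ε x‖
      ≤ D * ‖x‖ * ‖f x‖ + K * ‖x‖⁻¹ * ‖f x - q x‖ := by
        rw [hdecomp]
        refine norm_add_le_of_le ?_ ?_
        · rw [norm_smul]
          gcongr
          exact hD ε _ _ (norm_nonneg x) hσ_ge hσ_le hxε
        · rw [norm_smul, norm_mul, norm_inv, norm_norm]
          gcongr
          exact hK _ (div_nonneg (norm_nonneg x) ((norm_nonneg x).trans hxε))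
    _ = D * (‖x‖ * ‖f x‖) + K * (‖x‖⁻¹ * ‖f x - q x‖) := by ring
    _ ≤ c * ‖x‖ := by simpa using (le_abs_self _).trans hsmall
    _ ≤ c * ε := by gcongr

end ModelIntegrand

section ModelIntegral

variable {V F : Type*} [NormedAddCommGroup V] [InnerProductSpace ℝ V] [FiniteDimensional ℝ V]
  [MeasurableSpace V] [BorelSpace V] [NormedAddCommGroup F] [NormedSpace ℝ F] {w : ℝ → ℝ}
  {ℓ : V →L[ℝ] F} {b : V →L[ℝ] V →L[ℝ] F} {ε : ℝ}

lemma aestronglyMeasurable_modelIntegrand (hw : IsRadialProfile w) (hε : 0 ≤ ε) {μ : Measure V} :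
    AEStronglyMeasurable (modelIntegrand w ℓ b ε) μ :=
  (hw.continuous_comp_norm_div hε).aestronglyMeasurable.smul
    (measurable_norm.inv.aestronglyMeasurable.smul
      (Continuous.aestronglyMeasurable (by fun_prop)))

lemma integrable_comp_norm_div_mul (hw : IsRadialProfile w) (hε : 0 < ε) {q : V → ℝ}
    (hq : Continuous q) : Integrable fun x : V => w (‖x‖ / ε) * q x := by
  refine ((hw.continuous_comp_norm_div hε.le).mul hq).integrable_of_hasCompactSupport
    (.intro (isCompact_closedBall 0 ε) fun x hx => ?_)
  rw [mem_closedBall_zero_iff, not_le] at hx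
  simp [hw.comp_norm_div_eq_zero hε hx]

lemma integrable_modelIntegrand (hw : IsRadialProfile w) (hε : 0 < ε) :
    Integrable (modelIntegrand w ℓ b ε) := by
  refine (integrable_comp_norm_div_mul hw hε (q := fun x => ‖ℓ‖ + ‖b‖ * ‖x‖) (by fun_prop)).mono
    (aestronglyMeasurable_modelIntegrand hw hε.le) (ae_of_all _ fun x => ?_)
  rw [modelIntegrand, norm_smul, norm_mul]
  gcongr
  exact (norm_inv_smul_add_bilin_le ℓ b x).trans (Real.le_norm_self _)

lemma integral_modelIntegrand_eq_quadratic (hw : IsRadialProfile w) (hε : 0 < ε) :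
    ∫ x, modelIntegrand w ℓ b ε x = ∫ x, (w (‖x‖ / ε) * ‖x‖⁻¹) • b x x := by
  have hsplit : ∀ x, modelIntegrand w ℓ b ε x =
      modelIntegrand w ℓ 0 ε x + modelIntegrand w 0 b ε x := fun x => by simp [modelIntegrand]
  have hodd : ∫ x, modelIntegrand w ℓ 0 ε x = 0 :=
    integral_eq_zero_of_odd fun x => by simp [modelIntegrand]
  simp only [hsplit]
  rw [integral_add (integrable_modelIntegrand hw hε) (integrable_modelIntegrand hw hε), hodd,
    zero_add]
  simp [modelIntegrand, smul_smul]

lemma integral_modelIntegrand [CompleteSpace F] [Nontrivial V] {ι : Type*} [Fintype ι]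
    (hw : IsRadialProfile w) (hε : 0 < ε) (e : OrthonormalBasis ι ℝ V) :
    ∫ x, modelIntegrand w ℓ b ε x =
      (ε ^ (Module.finrank ℝ V + 1) * ((Module.finrank ℝ V : ℝ)⁻¹ *
        kernelConst (Module.finrank ℝ V) fun t => w t * t)) • ∑ i, b (e i) (e i) := by
  have hradial : ∀ x : V, w (‖x‖ / ε) * ‖x‖⁻¹ * ‖x‖ ^ 2 = w (‖x‖ / ε) * ‖x‖ := fun x => by
    rcases eq_or_ne ‖x‖ 0 with hx | hx
    · simp [hx]
    · field_simp
  have hmoment : ∫ x : V, w (‖x‖ / ε) * ‖x‖ =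
      ε * (ε ^ Module.finrank ℝ V * kernelConst (Module.finrank ℝ V) fun t => w t * t) := by
    rw [← integral_comp_norm_div (V := V) (fun t ht => by rw [hw.eq_zero t ht, zero_mul]) hε.le,
      ← integral_const_mul]
    exact integral_congr_ae (ae_of_all _ fun x => by field_simp)
  rw [integral_modelIntegrand_eq_quadratic hw hε,
    integral_comp_norm_smul_bilin (u := fun t => w (t / ε) * t⁻¹)
      ((hw.continuous_comp_norm_div hε.le).aestronglyMeasurable.mul
        measurable_norm.inv.aestronglyMeasurable)
      (by simpa only [hradial] using integrable_comp_norm_div_mul hw hε continuous_norm) e b]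
  simp only [hradial, hmoment, ← Module.finrank_eq_card_basis e.toBasis]
  congr 1
  ring

lemma integral_modelIntegrand_derivWithin [CompleteSpace F] [Nontrivial V] {ι : Type*} [Fintype ι]
    {ρ : ℝ → ℝ} (hρ : ContDiffOn ℝ 2 ρ (Ici 0)) (hρ₁ : ∀ t, 1 < t → ρ t = 0) (hε : 0 < ε)
    (e : OrthonormalBasis ι ℝ V) :
    ∫ x, modelIntegrand (derivWithin ρ (Ici 0)) ℓ b ε x =
      (ε ^ (Module.finrank ℝ V + 1) * -kernelConst (Module.finrank ℝ V) ρ) •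
        ∑ i, b (e i) (e i) := by
  have hd : Module.finrank ℝ V ≠ 0 := Module.finrank_pos.ne'
  rw [integral_modelIntegrand (isRadialProfile_derivWithin hρ hρ₁) hε e,
    kernelConst_derivWithin_mul_self hd (hρ.of_le one_le_two) hρ₁, mul_neg,
    inv_mul_cancel_left₀ (Nat.cast_ne_zero.2 hd)]

end ModelIntegral

section Limits

lemma setIntegral_eq_and_integrableOn_iff_of_inter_eq {X G : Type*} [MeasurableSpace X]
    {μ : Measure X} [NormedAddCommGroup G] [NormedSpace ℝ G] {f : X → G} {s t t' : Set X}
    (hs : MeasurableSet s) (hst : s ∩ t = s ∩ t') (hf : ∀ x, x ∉ s → f x = 0) :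
    ∫ x in t, f x ∂μ = ∫ x in t', f x ∂μ ∧ (IntegrableOn f t μ ↔ IntegrableOn f t' μ) := by
  have hrestrict : (μ.restrict t).restrict s = (μ.restrict t').restrict s := by
    rw [Measure.restrict_restrict hs, Measure.restrict_restrict hs, hst]
  have hsupport : Function.support f ⊆ s := fun x hx => by_contra fun hxs => hx (hf x hxs)
  constructor
  · rw [← setIntegral_eq_integral_of_forall_compl_eq_zero hf, hrestrict,
      setIntegral_eq_integral_of_forall_compl_eq_zero hf]
  · rw [IntegrableOn, ← integrableOn_iff_integrable_of_support_subset hsupport, IntegrableOn,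
      hrestrict, ← IntegrableOn, integrableOn_iff_integrable_of_support_subset hsupport,
      ← IntegrableOn]

lemma eventually_one_add_mul_sq_pow_le (C : ℝ) (m : ℕ) {c : ℝ} (hc : 0 < c) :
    ∀ᶠ ε : ℝ in 𝓝[>] 0, (1 + C * ε ^ 2) ^ m - 1 ≤ c * ε ∧ (1 + C * ε ^ 2) ^ m ≤ 2 := by
  have hderiv : HasDerivAt (fun ε : ℝ => (1 + C * ε ^ 2) ^ m) 0 0 := by
    simpa using ((((hasDerivAt_id' (0 : ℝ)).fun_pow 2).const_mul C).const_add 1).fun_pow m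
  have hsmall := hderiv.isLittleO.def hc
  have hle : ∀ᶠ ε : ℝ in 𝓝 0, (1 + C * ε ^ 2) ^ m ≤ 2 :=
    hderiv.continuousAt.eventually (ge_mem_nhds (by norm_num))
  filter_upwards [nhdsWithin_le_nhds hsmall, nhdsWithin_le_nhds hle, self_mem_nhdsWithin]
    with ε hsmall hle (hε : 0 < ε)
  refine ⟨(le_abs_self _).trans ?_, hle⟩
  simpa [abs_of_pos hε] using hsmall

lemma isLittleO_of_forall_norm_le {α G : Type*} [NormedAddCommGroup G] {l : Filter α} {f : α → G}
    {r : α → ℝ} (K : ℝ) (h : ∀ c > 0, ∀ᶠ x in l, ‖f x‖ ≤ c * K * r x) : f =o[l] r := by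
  refine Asymptotics.isLittleO_iff.2 fun c hc => ?_
  filter_upwards [h (c / (|K| + 1)) (by positivity)] with x hx
  have hle : K * r x ≤ (|K| + 1) * ‖r x‖ :=
    (le_abs_self _).trans ((abs_mul K (r x)).trans_le (by gcongr; exacts [by simp, le_rfl]))
  calc ‖f x‖ ≤ c / (|K| + 1) * (K * r x) := by rwa [← mul_assoc]
    _ ≤ c / (|K| + 1) * ((|K| + 1) * ‖r x‖) := mul_le_mul_of_nonneg_left hle (by positivity)
    _ = c * ‖r x‖ := by field_simp

lemma tendsto_inv_smul_of_isLittleO {α G : Type*} [NormedAddCommGroup G] [NormedSpace ℝ G]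
    {l : Filter α} {f : α → G} {r : α → ℝ} {v : G} (hr : ∀ᶠ x in l, r x ≠ 0)
    (h : (fun x => f x - r x • v) =o[l] r) : Tendsto (fun x => (r x)⁻¹ • f x) l (𝓝 v) := by
  have hlim := h.tendsto_inv_smul_nhds_zero.add_const v
  rw [zero_add] at hlim
  refine hlim.congr' (hr.mono fun x hx => ?_)
  rw [smul_sub, inv_smul_smul₀ hx, sub_add_cancel]

end Limits

section Graph

local notation "𝔼" n:max => EuclideanSpace ℝ (Fin n)

variable {n d : ℕ} {M : Set (𝔼 n)} {a : 𝔼 n}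

lemma tanProj_coe (v : tanSpace M a) : tanProj M a v = v :=
  Submodule.starProjection_eq_self_iff.2 v.2

lemma norProj_apply (M : Set (𝔼 n)) (y v : 𝔼 n) : norProj M y v = v - tanProj M y v :=
  Submodule.starProjection_orthogonal_val v

/-- The condition imposed by `IsC2Submanifold` at the single point `a` of `M`. -/
def IsC2SubmanifoldAt (d : ℕ) (M : Set (𝔼 n)) (a : 𝔼 n) : Prop :=
  a ∈ M ∧ ∃ (Φ : OpenPartialHomeomorph (𝔼 n) (𝔼 n)) (L : Submodule ℝ (𝔼 n)),
    a ∈ Φ.source ∧ ContDiffOn ℝ 2 Φ Φ.source ∧ ContDiffOn ℝ 2 Φ.symm Φ.target ∧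
    Module.finrank ℝ L = d ∧ ∀ y ∈ Φ.source, (y ∈ M ↔ Φ y ∈ L)

lemma tangentConeAt_eq_preimage_of_mem_iff {Φ : OpenPartialHomeomorph (𝔼 n) (𝔼 n)}
    {L : Submodule ℝ (𝔼 n)} {A : 𝔼 n ≃L[ℝ] 𝔼 n} (ha : a ∈ M) (haΦ : a ∈ Φ.source)
    (hML : ∀ y ∈ Φ.source, (y ∈ M ↔ Φ y ∈ L)) (hA : HasFDerivAt Φ (A : 𝔼 n →L[ℝ] 𝔼 n) a)
    (hAsymm : HasFDerivAt Φ.symm (A.symm : 𝔼 n →L[ℝ] 𝔼 n) (Φ a)) :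
    tangentConeAt ℝ M a = A ⁻¹' L := by
  have hcone : tangentConeAt ℝ (L : Set (𝔼 n)) (Φ a) = L :=
    tangentConeAt_coe_submodule L.closed_of_finiteDimensional ((hML a haΦ).1 ha)
  refine Subset.antisymm (fun v hv => ?_) fun v hv => ?_
  · rw [← hcone]
    refine mapsTo_tangentConeAt_of_eventually_mem hA.hasFDerivWithinAt ?_ hv
    filter_upwards [self_mem_nhdsWithin, mem_nhdsWithin_of_mem_nhds
      (Φ.open_source.mem_nhds haΦ)] with y hyM hyΦ using (hML y hyΦ).1 hyM
  · have hv' : A v ∈ tangentConeAt ℝ (L : Set (𝔼 n)) (Φ a) := hcone.symm ▸ hv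
    have hmaps : A.symm (A v) ∈ tangentConeAt ℝ M (Φ.symm (Φ a)) := by
      refine mapsTo_tangentConeAt_of_eventually_mem hAsymm.hasFDerivWithinAt ?_ hv'
      filter_upwards [self_mem_nhdsWithin, mem_nhdsWithin_of_mem_nhds
        (Φ.open_target.mem_nhds (Φ.map_source haΦ))] with z hzL hzΦ
      rwa [hML _ (Φ.map_target hzΦ), Φ.right_inv hzΦ]
    rwa [A.symm_apply_apply, Φ.left_inv haΦ] at hmaps

lemma IsC2SubmanifoldAt.exists_straightening (hM : IsC2SubmanifoldAt d M a) :
    Module.finrank ℝ (tanSpace M a) = d ∧ ∃ Ψ : 𝔼 n → 𝔼 n, Ψ a = 0 ∧ ContDiffAt ℝ 2 Ψ a ∧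
      HasFDerivAt Ψ (ContinuousLinearMap.id ℝ (𝔼 n)) a ∧
      ∀ᶠ y in 𝓝 a, (y ∈ M ↔ Ψ y ∈ tanSpace M a) := by
  obtain ⟨ha, Φ, L, haΦ, hΦ, hΦsymm, hL, hML⟩ := hM
  have hΦa : ContDiffAt ℝ 2 Φ a := hΦ.contDiffAt (Φ.open_source.mem_nhds haΦ)
  obtain ⟨A, hA, hAsymm⟩ := exists_equiv_hasFDerivAt_openPartialHomeomorph Φ haΦ
    (hΦa.differentiableAt two_ne_zero)
    ((hΦsymm.contDiffAt (Φ.open_target.mem_nhds (Φ.map_source haΦ))).differentiableAt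
      two_ne_zero)
  have htan : tanSpace M a = L.comap A.toLinearEquiv.toLinearMap := by
    rw [tanSpace, tangentConeAt_eq_preimage_of_mem_iff ha haΦ hML hA hAsymm]
    exact Submodule.span_eq (L.comap A.toLinearEquiv.toLinearMap)
  refine ⟨by rw [htan, ← hL]; exact (A.toLinearEquiv.ofSubmodule' L).finrank_eq,
    fun y => A.symm (Φ y - Φ a), by simp,
    A.symm.contDiff.contDiffAt.comp a (hΦa.sub contDiffAt_const), ?_, ?_⟩
  · exact (A.symm.hasFDerivAt.comp a (hA.sub_const (Φ a))).congr_fderiv (by ext1 v; simp)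
  · filter_upwards [Φ.open_source.mem_nhds haΦ] with y hy
    rw [hML y hy, htan, Submodule.mem_comap]
    simpa using (L.sub_mem_iff_left ((hML a haΦ).1 ha)).symm

lemma IsC2SubmanifoldAt.finrank_tanSpace (hM : IsC2SubmanifoldAt d M a) :
    Module.finrank ℝ (tanSpace M a) = d :=
  hM.exists_straightening.1

/-- The germ at `0` of a `C²` map `φ` on the tangent space that parametrizes the germ of `M` at `a`
as a graph: `φ x - a` has tangential part `x`. -/
structure IsLocalGraph (M : Set (𝔼 n)) (a : 𝔼 n) (φ : tanSpace M a → 𝔼 n) : Prop where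
  contDiffAt : ContDiffAt ℝ 2 φ 0
  map_zero : φ 0 = a
  proj_apply : ∀ᶠ x in 𝓝 0, (tanSpace M a).orthogonalProjectionOnto (φ x - a) = x
  mem : ∀ᶠ x in 𝓝 0, φ x ∈ M
  apply_proj : ∀ᶠ y in 𝓝[M] a, φ ((tanSpace M a).orthogonalProjectionOnto (y - a)) = y

-- A chart `Ψ` with derivative the identity is corrected so as to preserve the tangential part of
-- `y - a`; the graph map is then the restriction of its local inverse.
lemma IsC2SubmanifoldAt.exists_adapted_chart (hM : IsC2SubmanifoldAt d M a) :
    ∃ G : 𝔼 n → 𝔼 n, G a = 0 ∧ ContDiffAt ℝ 2 G a ∧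
      HasFDerivAt G ((ContinuousLinearEquiv.refl ℝ (𝔼 n) : 𝔼 n ≃L[ℝ] 𝔼 n) : 𝔼 n →L[ℝ] 𝔼 n) a ∧
      (∀ y, (tanSpace M a).orthogonalProjectionOnto (G y) =
        (tanSpace M a).orthogonalProjectionOnto (y - a)) ∧
      ∀ᶠ y in 𝓝 a, (y ∈ M ↔ G y ∈ tanSpace M a) := by
  obtain ⟨-, Ψ, hΨa, hΨ, hΨ', hΨM⟩ := hM.exists_straightening
  set T := (tanSpace M a).starProjection with hT
  refine ⟨fun y => Ψ y + T (y - a - Ψ y), by simp [hΨa],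
    hΨ.add (T.contDiff.contDiffAt.comp a ((contDiffAt_id.sub contDiffAt_const).sub hΨ)), ?_,
    fun y => ?_, ?_⟩
  · exact (hΨ'.add (T.hasFDerivAt.comp a (((hasFDerivAt_id a).sub_const a).sub hΨ'))).congr_fderiv
      (by ext1 v; simp)
  · rw [map_add, hT, Submodule.starProjection_apply,
      Submodule.orthogonalProjectionOnto_mem_subspace_eq_self, ← map_add, add_sub_cancel]
  · filter_upwards [hΨM] with y hy
    rw [hy, Submodule.add_mem_iff_left _ (Submodule.starProjection_apply_mem _ _)]

lemma IsC2SubmanifoldAt.exists_isLocalGraph (hM : IsC2SubmanifoldAt d M a) :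
    ∃ φ, IsLocalGraph M a φ := by
  obtain ⟨G, hGa, hG, hG', hproj, hGM⟩ := hM.exists_adapted_chart
  set e := hG.toOpenPartialHomeomorph G hG' two_ne_zero
  have ha_source : a ∈ e.source := hG.mem_toOpenPartialHomeomorph_source hG' two_ne_zero
  have he_a : e a = 0 := hGa
  have h0_target : (0 : 𝔼 n) ∈ e.target := he_a ▸ e.map_source ha_source
  have hsymm_zero : e.symm 0 = a := he_a ▸ e.left_inv ha_source
  have hsymm : ContDiffAt ℝ 2 e.symm 0 := by
    have := hG.to_localInverse hG' two_ne_zero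
    rwa [hGa] at this
  have htendsto : Tendsto (fun x : tanSpace M a => (x : 𝔼 n)) (𝓝 0) (𝓝 0) :=
    continuous_subtype_val.tendsto' 0 0 rfl
  have hright : ∀ᶠ x : tanSpace M a in 𝓝 0, G (e.symm x) = x :=
    htendsto.eventually (e.eventually_right_inverse h0_target)
  have hleft : ∀ᶠ y in 𝓝 a, e.symm (G y) = y := e.eventually_left_inverse ha_source
  refine ⟨fun x => e.symm x, ?_, hsymm_zero, ?_, ?_, ?_⟩
  · exact ContDiffAt.comp (g := e.symm) (0 : tanSpace M a) hsymm
      (tanSpace M a).subtypeL.contDiff.contDiffAt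
  · filter_upwards [hright] with x hx
    rw [← hproj, hx, Submodule.orthogonalProjectionOnto_mem_subspace_eq_self]
  · have hsymm_tendsto : Tendsto (fun x : tanSpace M a => e.symm x) (𝓝 0) (𝓝 a) := by
      have := hsymm.continuousAt.tendsto.comp htendsto
      rwa [hsymm_zero] at this
    filter_upwards [hright, hsymm_tendsto.eventually hGM] with x hx hxM
    rw [hxM, hx]
    exact x.2
  · filter_upwards [mem_nhdsWithin_of_mem_nhds hGM, mem_nhdsWithin_of_mem_nhds hleft,
      self_mem_nhdsWithin] with y hy hyleft hyM
    rw [← hproj, ← Submodule.starProjection_apply,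
      Submodule.starProjection_eq_self_iff.2 (hy.1 hyM), hyleft]

namespace IsLocalGraph

variable {φ : tanSpace M a → 𝔼 n}

lemma tendsto (h : IsLocalGraph M a φ) : Tendsto φ (𝓝 0) (𝓝[M] a) :=
  tendsto_nhdsWithin_iff.2
    ⟨by simpa only [h.map_zero] using h.contDiffAt.continuousAt.tendsto, h.mem⟩

lemma eventually_contDiffAt (h : IsLocalGraph M a φ) : ∀ᶠ x in 𝓝 0, ContDiffAt ℝ 2 φ x :=
  h.contDiffAt.eventually (by simp)

lemma eventually_hasFDerivAt (h : IsLocalGraph M a φ) :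
    ∀ᶠ x in 𝓝 0, HasFDerivAt φ (fderiv ℝ φ x) x :=
  h.eventually_contDiffAt.mono fun _ hx => (hx.differentiableAt two_ne_zero).hasFDerivAt

lemma eventually_proj_comp_fderiv (h : IsLocalGraph M a φ) :
    ∀ᶠ x in 𝓝 0, (tanSpace M a).orthogonalProjectionOnto ∘L fderiv ℝ φ x =
      ContinuousLinearMap.id ℝ (tanSpace M a) := by
  filter_upwards [h.eventually_hasFDerivAt, h.proj_apply.eventually_nhds] with x hx hproj
  exact ((ContinuousLinearMap.hasFDerivAt _).comp x (hx.sub_const a)).unique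
    ((hasFDerivAt_id x).congr_of_eventuallyEq hproj)

lemma eventually_range_fderiv (h : IsLocalGraph M a φ) :
    ∀ᶠ x in 𝓝 0, (fderiv ℝ φ x).range = tanSpace M (φ x) := by
  filter_upwards [h.eventually_hasFDerivAt, h.mem.eventually_nhds, h.proj_apply,
    h.tendsto.eventually (eventually_eventually_nhdsWithin.2 h.apply_proj)]
    with x hφ hmem hproj hleft
  refine le_antisymm ?_ (Submodule.span_le.2 fun v hv => ?_)
  · rintro _ ⟨v, rfl⟩
    refine Submodule.subset_span (mapsTo_tangentConeAt_of_eventually_mem (s := univ)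
      hφ.hasFDerivWithinAt (by rwa [nhdsWithin_univ]) ?_)
    simp
  · have hcomp : HasFDerivWithinAt (fun y => φ ((tanSpace M a).orthogonalProjectionOnto (y - a)))
        (fderiv ℝ φ x ∘L (tanSpace M a).orthogonalProjectionOnto) M (φ x) := by
      rw [← hproj] at hφ
      have := HasFDerivAt.comp (φ x) hφ
        ((tanSpace M a).orthogonalProjectionOnto.hasFDerivAt.comp (φ x)
          ((hasFDerivAt_id (φ x)).sub_const a))
      rw [hproj] at this
      exact this.hasFDerivWithinAt
    have hid : HasFDerivWithinAt (fun y => φ ((tanSpace M a).orthogonalProjectionOnto (y - a)))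
        (ContinuousLinearMap.id ℝ (𝔼 n)) M (φ x) :=
      (hasFDerivWithinAt_id (φ x) M).congr_of_eventuallyEq hleft
        (hleft.self_of_nhdsWithin hmem.self_of_nhds)
    exact ⟨_, hcomp.unique_on hid hv⟩

lemma fderiv_zero (h : IsLocalGraph M a φ) : fderiv ℝ φ 0 = (tanSpace M a).subtypeL := by
  ext1 v
  have hrange : fderiv ℝ φ 0 v ∈ tanSpace M (φ 0) :=
    h.eventually_range_fderiv.self_of_nhds ▸ ⟨v, rfl⟩
  rw [h.map_zero] at hrange
  rw [← Submodule.starProjection_eq_self_iff.2 hrange]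
  exact congrArg Subtype.val (DFunLike.congr_fun h.eventually_proj_comp_fderiv.self_of_nhds v)

lemma contDiffAt_fderiv (h : IsLocalGraph M a φ) : ContDiffAt ℝ 1 (fderiv ℝ φ) 0 :=
  h.contDiffAt.fderiv_right (by norm_num)

lemma contDiffAt_tanProj (h : IsLocalGraph M a φ) :
    ContDiffAt ℝ 1 (fun x => tanProj M (φ x)) 0 := by
  have hinj : Function.Injective (fderiv ℝ φ 0) := by
    rw [h.fderiv_zero]; exact Subtype.val_injective
  refine (ContDiffAt.comp (0 : tanSpace M a) (contDiffAt_starProjection_range hinj)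
    h.contDiffAt_fderiv).congr_of_eventuallyEq ?_
  filter_upwards [h.eventually_range_fderiv] with x hx
  simp only [tanProj, Function.comp_apply, hx]

lemma hasFDerivAt_tanProj (h : IsLocalGraph M a φ) :
    HasFDerivAt (fun x => tanProj M (φ x)) (fderiv ℝ (fun x => tanProj M (φ x)) 0) 0 :=
  (h.contDiffAt_tanProj.differentiableAt one_ne_zero).hasFDerivAt

lemma hasFDerivAt_fderiv_apply (h : IsLocalGraph M a φ) (v : tanSpace M a) :
    HasFDerivAt (fun x => fderiv ℝ φ x v) ((fderiv ℝ (fderiv ℝ φ) 0).flip v) 0 :=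
  ((h.contDiffAt_fderiv.differentiableAt one_ne_zero).hasFDerivAt.clm_apply
    (hasFDerivAt_const v 0)).congr_fderiv (by ext1 u; simp)

lemma tanProj_hessian (h : IsLocalGraph M a φ) (u v : tanSpace M a) :
    tanProj M a (fderiv ℝ (fderiv ℝ φ) 0 u v) = 0 := by
  have hcomp := (tanProj M a).hasFDerivAt.comp (0 : tanSpace M a) (h.hasFDerivAt_fderiv_apply v)
  have hconst : (fun x => tanProj M a (fderiv ℝ φ x v)) =ᶠ[𝓝 0] fun _ => (v : 𝔼 n) := by
    filter_upwards [h.eventually_proj_comp_fderiv] with x hx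
    exact congrArg Subtype.val (DFunLike.congr_fun hx v)
  exact DFunLike.congr_fun
    (hcomp.unique ((hasFDerivAt_const (v : 𝔼 n) 0).congr_of_eventuallyEq hconst)) u

-- Differentiate `S_y (Dφ v) = Dφ v`.
lemma fderiv_tanProj_apply (h : IsLocalGraph M a φ) (u v : tanSpace M a) :
    fderiv ℝ (fun x => tanProj M (φ x)) 0 u v = fderiv ℝ (fderiv ℝ φ) 0 u v := by
  have hfix : (fun x => tanProj M (φ x) (fderiv ℝ φ x v)) =ᶠ[𝓝 0] fun x => fderiv ℝ φ x v := by
    filter_upwards [h.eventually_range_fderiv] with x hx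
    exact Submodule.starProjection_eq_self_iff.2 (hx ▸ ⟨v, rfl⟩)
  have hderiv := DFunLike.congr_fun ((h.hasFDerivAt_tanProj.clm_apply
    (h.hasFDerivAt_fderiv_apply v)).unique
      ((h.hasFDerivAt_fderiv_apply v).congr_of_eventuallyEq hfix)) u
  simpa [h.map_zero, h.fderiv_zero, h.tanProj_hessian] using hderiv

lemma secondFundForm_eq_hessian (h : IsLocalGraph M a φ) (u v : tanSpace M a) :
    secondFundForm M a u v = fderiv ℝ (fderiv ℝ φ) 0 u v := by
  set p := (tanSpace M a).orthogonalProjectionOnto with hp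
  set Q' := fderiv ℝ (fun x => tanProj M (φ x)) 0 with hQ'
  have hcomp : HasFDerivAt (fun y => tanProj M (φ (p (y - a))) v) (Q'.flip v ∘L p) a := by
    have hQ : HasFDerivAt (fun x => tanProj M (φ x)) Q' (p (a - a)) := by
      rw [sub_self a, _root_.map_zero p]; exact h.hasFDerivAt_tanProj
    exact ((hQ.comp a (p.hasFDerivAt.comp a ((hasFDerivAt_id a).sub_const a))).clm_apply
      (hasFDerivAt_const (v : 𝔼 n) a)).congr_fderiv (by ext1 w; simp)
  have hwithin : HasFDerivWithinAt (fun y => tanProj M y v) (Q'.flip v ∘L p) M a := by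
    refine hcomp.hasFDerivWithinAt.congr_of_eventuallyEq ?_ ?_
    · filter_upwards [h.apply_proj] with y hy
      rw [hy]
    · rw [sub_self a, _root_.map_zero p, h.map_zero]
  have hspan : EqOn (fderivWithin ℝ (fun y => tanProj M y v) M a) (Q'.flip v ∘L p)
      (tanSpace M a) :=
    LinearMap.eqOn_span (hwithin.differentiableWithinAt.hasFDerivWithinAt.unique_on hwithin)
  have hu : fderivWithin ℝ (fun y => tanProj M y v) M a u = fderiv ℝ (fderiv ℝ φ) 0 u v := by
    rw [hspan u.2, ← h.fderiv_tanProj_apply]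
    simp [hp, hQ']
  rw [secondFundForm, hu, norProj_apply, h.tanProj_hessian, sub_zero]

lemma meanCurvature_eq_trace_hessian (h : IsLocalGraph M a φ) :
    meanCurvature M a = ∑ i, fderiv ℝ (fderiv ℝ φ) 0 (stdOrthonormalBasis ℝ (tanSpace M a) i)
      (stdOrthonormalBasis ℝ (tanSpace M a) i) :=
  Finset.sum_congr rfl fun _ _ => h.secondFundForm_eq_hessian _ _

lemma hasQuadraticExpansion_id (h : IsLocalGraph M a φ) :
    HasQuadraticExpansion (fun x => φ x - a) (tanSpace M a).subtypeL
      ((1 / 2 : ℝ) • fderiv ℝ (fderiv ℝ φ) 0) where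
  continuousAt := h.eventually_contDiffAt.mono fun _ hx => hx.continuousAt.sub continuousAt_const
  isLittleO := by simpa [h.map_zero, h.fderiv_zero] using isLittleO_taylor_two h.contDiffAt

lemma hasQuadraticExpansion_tanProj_clm_apply (h : IsLocalGraph M a φ) {f : tanSpace M a → 𝔼 n}
    {b : tanSpace M a →L[ℝ] tanSpace M a →L[ℝ] 𝔼 n} (hb : ∀ x, tanProj M a (b x x) = 0)
    (hf : HasQuadraticExpansion f (tanSpace M a).subtypeL b) :
    HasQuadraticExpansion (fun x => tanProj M (φ x) (f x)) (tanSpace M a).subtypeL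
      (fderiv ℝ (fderiv ℝ φ) 0) :=
  (hf.clm_apply h.hasFDerivAt_tanProj ((h.contDiffAt_tanProj.eventually (by simp)).mono
    fun _ hx => hx.continuousAt)).of_eq (fun _ => rfl)
    (fun x => by simp [h.map_zero, tanProj_coe])
    (fun x => by simp [h.map_zero, hb, h.fderiv_tanProj_apply])

lemma hasQuadraticExpansion_base (h : IsLocalGraph M a φ) :
    HasQuadraticExpansion (fun x => tanProj M a (φ x - a)) (tanSpace M a).subtypeL 0 :=
  (h.hasQuadraticExpansion_id.clm_comp (tanProj M a)).of_eq (fun _ => rfl)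
    (fun x => by simp [tanProj_coe]) (fun x => by simp [h.tanProj_hessian])

lemma hasQuadraticExpansion_moving (h : IsLocalGraph M a φ) :
    HasQuadraticExpansion (fun x => tanProj M (φ x) (φ x - a)) (tanSpace M a).subtypeL
      (fderiv ℝ (fderiv ℝ φ) 0) :=
  h.hasQuadraticExpansion_tanProj_clm_apply (fun x => by simp [h.tanProj_hessian])
    h.hasQuadraticExpansion_id

lemma hasQuadraticExpansion_moving_base (h : IsLocalGraph M a φ) :
    HasQuadraticExpansion (fun x => (tanProj M (φ x) ∘L tanProj M a) (φ x - a))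
      (tanSpace M a).subtypeL (fderiv ℝ (fderiv ℝ φ) 0) :=
  h.hasQuadraticExpansion_tanProj_clm_apply (fun x => by simp) h.hasQuadraticExpansion_base

lemma hasQuadraticExpansion_base_moving (h : IsLocalGraph M a φ) :
    HasQuadraticExpansion (fun x => (tanProj M a ∘L tanProj M (φ x)) (φ x - a))
      (tanSpace M a).subtypeL 0 :=
  (h.hasQuadraticExpansion_moving.clm_comp (tanProj M a)).of_eq (fun _ => rfl)
    (fun x => by simp [tanProj_coe]) (fun x => by simp [h.tanProj_hessian])

lemma hasQuadraticExpansion_norProj_norProj (h : IsLocalGraph M a φ) :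
    HasQuadraticExpansion (fun x => ((2 : ℝ) • (norProj M (φ x) ∘L norProj M a)) (φ x - a))
      0 (fderiv ℝ (fderiv ℝ φ) 0) :=
  (((h.hasQuadraticExpansion_id.sub h.hasQuadraticExpansion_base).sub
    (h.hasQuadraticExpansion_moving.sub h.hasQuadraticExpansion_moving_base)).const_smul 2).of_eq
    (fun x => by simp [norProj_apply]) (fun x => by simp) (fun x => by simp)

lemma hasQuadraticExpansion_neg_norProj_tanProj (h : IsLocalGraph M a φ) :
    HasQuadraticExpansion (fun x => (-(norProj M (φ x) ∘L tanProj M a)) (φ x - a))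
      0 (fderiv ℝ (fderiv ℝ φ) 0) :=
  (h.hasQuadraticExpansion_moving_base.sub h.hasQuadraticExpansion_base).of_eq
    (fun x => by simp [norProj_apply]) (fun x => by simp) (fun x => by simp)

lemma hasQuadraticExpansion_tanProj_norProj (h : IsLocalGraph M a φ) :
    HasQuadraticExpansion (fun x => (tanProj M (φ x) ∘L norProj M a) (φ x - a)) 0 0 :=
  (h.hasQuadraticExpansion_moving.sub h.hasQuadraticExpansion_moving_base).of_eq
    (fun x => by simp [norProj_apply]) (fun x => by simp) (fun x => by simp)

lemma hasQuadraticExpansion_base_norProj (h : IsLocalGraph M a φ) :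
    HasQuadraticExpansion (fun x => (tanProj M a ∘L norProj M (φ x)) (φ x - a)) 0 0 :=
  (h.hasQuadraticExpansion_base.sub h.hasQuadraticExpansion_base_moving).of_eq
    (fun x => by simp [norProj_apply]) (fun x => by simp) (fun x => by simp)

lemma exists_lipschitzOnWith (h : IsLocalGraph M a φ) :
    ∃ C : ℝ, 0 ≤ C ∧ ∀ᶠ ε in 𝓝 0,
      LipschitzOnWith (1 + C * ε ^ 2).toNNReal φ (Metric.closedBall 0 ε) := by
  obtain ⟨C, hC, hfderiv⟩ :=
    (h.contDiffAt_fderiv.differentiableAt one_ne_zero).hasFDerivAt.isBigO_sub.exists_pos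
  refine ⟨C ^ 2, by positivity, ?_⟩
  filter_upwards [eventually_forall_closedBall
    (h.eventually_hasFDerivAt.and (h.proj_apply.and hfderiv.bound))] with ε hε
  refine LipschitzOnWith.of_dist_le_mul fun x hx x' hx' => ?_
  rw [Real.coe_toNNReal _ (by positivity), dist_eq_norm, dist_eq_norm]
  set ψ : tanSpace M a → 𝔼 n := fun z => φ z - z
  have hψ : ‖ψ x - ψ x'‖ ≤ C * ε * ‖x - x'‖ := by
    refine (convex_closedBall 0 ε).norm_image_sub_le_of_norm_hasFDerivWithin_le
      (f' := fun z => fderiv ℝ φ z - (tanSpace M a).subtypeL) (fun z hz =>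
        ((hε z hz).1.sub (tanSpace M a).subtypeL.hasFDerivAt).hasFDerivWithinAt) (fun z hz => ?_)
      hx' hx
    calc ‖fderiv ℝ φ z - (tanSpace M a).subtypeL‖ ≤ C * ‖z‖ := by
          simpa [h.fderiv_zero] using (hε z hz).2.2
      _ ≤ C * ε := by gcongr; exact mem_closedBall_zero_iff.1 hz
  have horth : inner ℝ ((x - x' : tanSpace M a) : 𝔼 n) (ψ x - ψ x') = 0 := by
    refine Submodule.inner_right_of_mem_orthogonal (K := tanSpace M a) (x - x').2
      (Submodule.orthogonalProjectionOnto_eq_zero_iff.1 ?_)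
    have hψ_eq : ψ x - ψ x' = (φ x - a) - (φ x' - a) - ((x - x' : tanSpace M a) : 𝔼 n) := by
      simp only [ψ, Submodule.coe_sub]; abel
    rw [hψ_eq, map_sub, map_sub, (hε x hx).2.1, (hε x' hx').2.1,
      Submodule.orthogonalProjectionOnto_mem_subspace_eq_self, sub_self]
  have hpyth := norm_add_sq_eq_norm_sq_add_norm_sq_of_inner_eq_zero _ _ horth
  have hsum : ((x - x' : tanSpace M a) : 𝔼 n) + (ψ x - ψ x') = φ x - φ x' := by
    simp only [ψ, Submodule.coe_sub]; abel
  rw [hsum, Submodule.norm_coe] at hpyth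
  refine (pow_le_pow_iff_left₀ (norm_nonneg _) (by positivity) two_ne_zero).1 ?_
  calc ‖φ x - φ x'‖ ^ 2 ≤ ‖x - x'‖ ^ 2 + (C * ε * ‖x - x'‖) ^ 2 := by
        rw [sq ‖φ x - φ x'‖, hpyth, ← sq, ← sq]; gcongr
    _ ≤ ((1 + C ^ 2 * ε ^ 2) * ‖x - x'‖) ^ 2 := by
        nlinarith [sq_nonneg (C ^ 2 * ε ^ 2 * ‖x - x'‖), sq_nonneg (C * ε * ‖x - x'‖)]

lemma exists_eventually_norm_sub_le (h : IsLocalGraph M a φ) :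
    ∃ C : ℝ, ∀ᶠ x in 𝓝 0, ‖x‖ ≤ ‖φ x - a‖ ∧ ‖φ x - a‖ ≤ ‖x‖ + C * ‖x‖ ^ 3 := by
  obtain ⟨C, hC, hLip⟩ := h.exists_lipschitzOnWith
  refine ⟨C, ?_⟩
  filter_upwards [h.proj_apply, tendsto_norm_zero.eventually hLip] with x hproj hx
  constructor
  · conv_lhs => rw [← hproj]
    exact (tanSpace M a).norm_orthogonalProjectionOnto_apply_le _
  · have hle := hx.norm_sub_le (x := x) (y := 0) (by simp) (by simp)
    rw [Real.coe_toNNReal _ (by positivity), h.map_zero, sub_zero] at hle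
    linarith

lemma eventually_closedBall_inter (h : IsLocalGraph M a φ) :
    ∀ᶠ ε in 𝓝 (0 : ℝ), Metric.closedBall a ε ∩ M =
      Metric.closedBall a ε ∩ φ '' Metric.closedBall 0 ε := by
  filter_upwards [eventually_forall_closedBall h.mem,
    eventually_forall_closedBall (eventually_nhdsWithin_iff.1 h.apply_proj)] with ε hmem hleft
  refine Subset.antisymm (fun y hy => ⟨hy.1, _, ?_, hleft y hy.1 hy.2⟩)
    (inter_subset_inter_right _ (image_subset_iff.2 hmem))
  rw [mem_closedBall_zero_iff]
  exact ((tanSpace M a).norm_orthogonalProjectionOnto_apply_le _).trans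
    (mem_closedBall_iff_norm.1 hy.1)

variable {G : Type*} [NormedAddCommGroup G] [NormedSpace ℝ G]

lemma eventually_integrable_and_norm_integral_sub_le (h : IsLocalGraph M a φ) {F : ℝ → 𝔼 n → G}
    {g : ℝ → tanSpace M a → G} {A c : ℝ} (hA : 0 ≤ A) (hc : 0 < c)
    (hF : ∀ᶠ ε in 𝓝[>] 0, ∀ y, y ∉ Metric.closedBall a ε → F ε y = 0)
    (hFm : ∀ᶠ ε in 𝓝[>] 0,
      AEStronglyMeasurable (F ε ∘ φ) (volume.restrict (Metric.closedBall 0 ε)))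
    (hgm : ∀ᶠ ε in 𝓝[>] 0,
      AEStronglyMeasurable (g ε) (volume.restrict (Metric.closedBall 0 ε)))
    (hgA : ∀ᶠ ε in 𝓝[>] 0, ∀ x ∈ Metric.closedBall 0 ε, ‖g ε x‖ ≤ A)
    (hFg : ∀ᶠ ε in 𝓝[>] 0, ∀ x ∈ Metric.closedBall 0 ε, ‖F ε (φ x) - g ε x‖ ≤ c * ε) :
    ∀ᶠ ε in 𝓝[>] 0, Integrable (F ε) (weightMeasure (Module.finrank ℝ (tanSpace M a)) M) ∧
      ‖∫ y, F ε y ∂weightMeasure (Module.finrank ℝ (tanSpace M a)) M -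
          ∫ x in Metric.closedBall 0 ε, g ε x‖ ≤
        c * ((2 + A) * volume.real (Metric.ball (0 : tanSpace M a) 1)) *
          ε ^ (Module.finrank ℝ (tanSpace M a) + 1) := by
  set m := Module.finrank ℝ (tanSpace M a)
  obtain ⟨C, hC, hLip⟩ := h.exists_lipschitzOnWith
  filter_upwards [hF, hFm, hgm, hgA, hFg, nhdsWithin_le_nhds hLip,
    eventually_one_add_mul_sq_pow_le C m hc, nhdsWithin_le_nhds h.eventually_closedBall_inter,
    nhdsWithin_le_nhds (eventually_forall_closedBall h.proj_apply), self_mem_nhdsWithin]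
    with ε hF hFm hgm hgA hFg hLip hdistortion hinter hproj (hε : 0 < ε)
  have hp : LipschitzWith 1 fun y => (tanSpace M a).orthogonalProjectionOnto (y - a) :=
    LipschitzWith.of_dist_le_mul fun y y' => by
      simpa [dist_eq_norm, ← map_sub] using
        (tanSpace M a).norm_orthogonalProjectionOnto_apply_le (y - y')
  obtain ⟨hint, hle⟩ := integrableOn_image_and_norm_sub_le (isCompact_closedBall 0 ε) hp hproj hLip
    hFm hgm (mul_pos hc hε).le hA hFg hgA
  obtain ⟨heq, hiff⟩ := setIntegral_eq_and_integrableOn_iff_of_inter_eq (μ := μHE[m])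
    Metric.isClosed_closedBall.measurableSet hinter hF
  refine ⟨hiff.2 hint, ?_⟩
  rw [weightMeasure, heq]
  refine hle.trans ?_
  rw [Real.coe_toNNReal _ (by positivity), Measure.addHaar_real_closedBall _ _ hε.le]
  calc (c * ε * (1 + C * ε ^ 2) ^ m + A * ((1 + C * ε ^ 2) ^ m - 1)) *
        (ε ^ m * volume.real (Metric.ball (0 : tanSpace M a) 1))
      ≤ (c * ε * 2 + A * (c * ε)) * (ε ^ m * volume.real (Metric.ball (0 : tanSpace M a) 1)) := by
        gcongr
        exacts [hdistortion.2, hdistortion.1]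
    _ = c * ((2 + A) * volume.real (Metric.ball (0 : tanSpace M a) 1)) * ε ^ (m + 1) := by ring

lemma eventually_continuousOn (h : IsLocalGraph M a φ) :
    ∀ᶠ ε in 𝓝 (0 : ℝ), ContinuousOn φ (Metric.closedBall 0 ε) :=
  (eventually_forall_closedBall h.eventually_hasFDerivAt).mono fun _ hε x hx =>
    (hε x hx).continuousAt.continuousWithinAt

lemma isLittleO_integral_comp_norm_sub (h : IsLocalGraph M a φ) [Nontrivial (tanSpace M a)]
    {ξ : ℝ → ℝ} (hξ : IsRadialProfile ξ) :
    (fun ε => ∫ y, ξ (‖y - a‖ / ε) ∂weightMeasure (Module.finrank ℝ (tanSpace M a)) M -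
        ε ^ Module.finrank ℝ (tanSpace M a) * kernelConst (Module.finrank ℝ (tanSpace M a)) ξ)
      =o[𝓝[>] 0] fun ε => ε ^ (Module.finrank ℝ (tanSpace M a) + 1) := by
  obtain ⟨A, hA₀, hA⟩ := hξ.exists_norm_le
  obtain ⟨C, hC⟩ := h.exists_eventually_norm_sub_le
  obtain ⟨D, hD⟩ := hξ.exists_norm_apply_div_sub_le C
  have hpos : ∀ᶠ ε : ℝ in 𝓝[>] 0, 0 < ε := self_mem_nhdsWithin
  have hsmall := (isLittleO_norm_sq_norm (E := tanSpace M a)).const_mul_left D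
  refine isLittleO_of_forall_norm_le ((2 + A) * volume.real (Metric.ball (0 : tanSpace M a) 1))
    fun c hc => ?_
  have hclose := h.eventually_integrable_and_norm_integral_sub_le (c := c)
    (F := fun ε y => ξ (‖y - a‖ / ε)) (g := fun ε x => ξ (‖x‖ / ε)) hA₀ hc ?_ ?_ ?_ ?_ ?_
  · filter_upwards [hclose, hpos] with ε hε hεpos
    rw [setIntegral_eq_integral_of_forall_compl_eq_zero fun x hx =>
      hξ.comp_norm_div_eq_zero hεpos (by simpa using hx),
      integral_comp_norm_div hξ.eq_zero hεpos.le] at hε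
    exact hε.2
  · filter_upwards [hpos] with ε hε y hy
    exact hξ.comp_norm_div_eq_zero hε (by simpa [dist_eq_norm] using hy)
  · filter_upwards [hpos, nhdsWithin_le_nhds h.eventually_continuousOn] with ε hε hφ
    exact ((hξ.continuous_comp_norm_div hε.le).comp_continuousOn (hφ.sub continuousOn_const)
      ).aestronglyMeasurable Metric.isClosed_closedBall.measurableSet
  · filter_upwards [hpos] with ε hε
    exact (hξ.continuous_comp_norm_div hε.le).aestronglyMeasurable
  · filter_upwards [hpos] with ε hε x _ using hA _ (div_nonneg (norm_nonneg x) hε.le)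
  · filter_upwards [nhdsWithin_le_nhds (eventually_forall_closedBall (hC.and (hsmall.def hc)))]
      with ε hε x hx
    obtain ⟨⟨hge, hle⟩, hsq⟩ := hε x hx
    have hxε : ‖x‖ ≤ ε := mem_closedBall_zero_iff.1 hx
    calc ‖ξ (‖φ x - a‖ / ε) - ξ (‖x‖ / ε)‖ ≤ D * ‖x‖ ^ 2 := hD ε _ _ (norm_nonneg x) hge hle hxε
      _ ≤ c * ‖x‖ := by simpa using (le_abs_self _).trans hsq
      _ ≤ c * ε := by gcongr

lemma tendsto_mollifiedMass (h : IsLocalGraph M a φ) [Nontrivial (tanSpace M a)] {ξ : ℝ → ℝ}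
    (hξ : IsRadialProfile ξ) :
    Tendsto (mollifiedMass (Module.finrank ℝ (tanSpace M a)) ξ
        (weightMeasure (Module.finrank ℝ (tanSpace M a)) M) a) (𝓝[>] 0)
      (𝓝 (kernelConst (Module.finrank ℝ (tanSpace M a)) ξ)) := by
  refine tendsto_inv_smul_of_isLittleO (eventually_mem_nhdsWithin.mono fun ε hε =>
    pow_ne_zero _ (ne_of_gt hε)) ((h.isLittleO_integral_comp_norm_sub hξ).trans_isBigO ?_)
  simpa [pow_succ] using (Asymptotics.isBigO_refl (fun ε : ℝ =>
    ε ^ Module.finrank ℝ (tanSpace M a)) (𝓝[>] 0)).mul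
      (((continuous_id.tendsto (0 : ℝ)).isBigO_one ℝ).mono nhdsWithin_le_nhds)

section Curvature

variable {ρ : ℝ → ℝ} {P : 𝔼 n → 𝔼 n →L[ℝ] 𝔼 n} {ℓ : tanSpace M a →L[ℝ] 𝔼 n}
  {b : tanSpace M a →L[ℝ] tanSpace M a →L[ℝ] 𝔼 n}

lemma curvatureIntegrand_comp_eq (ε : ℝ) (x : tanSpace M a) :
    curvatureIntegrand ρ P a ε (φ x) =
      derivWithin ρ (Ici 0) (‖φ x - a‖ / ε) • ‖φ x - a‖⁻¹ • P (φ x) (φ x - a) := by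
  rw [curvatureIntegrand, map_smul]

lemma eventually_aestronglyMeasurable_curvatureIntegrand (h : IsLocalGraph M a φ)
    (hw : IsRadialProfile (derivWithin ρ (Ici 0)))
    (hP : HasQuadraticExpansion (fun x => P (φ x) (φ x - a)) ℓ b) :
    ∀ᶠ ε in 𝓝[>] 0, AEStronglyMeasurable (curvatureIntegrand ρ P a ε ∘ φ)
      (volume.restrict (Metric.closedBall 0 ε)) := by
  filter_upwards [self_mem_nhdsWithin, nhdsWithin_le_nhds h.eventually_continuousOn,
    nhdsWithin_le_nhds (eventually_forall_closedBall hP.continuousAt)] with ε hε hφ hPφ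
  have hball : MeasurableSet (Metric.closedBall (0 : tanSpace M a) ε) :=
    Metric.isClosed_closedBall.measurableSet
  have hsub : ContinuousOn (fun x => φ x - a) (Metric.closedBall 0 ε) :=
    hφ.sub continuousOn_const
  have hP' : ContinuousOn (fun x => P (φ x) (φ x - a)) (Metric.closedBall 0 ε) := fun x hx =>
    (hPφ x hx).continuousWithinAt
  exact ((((hw.continuous_comp_norm_div (le_of_lt hε)).comp_continuousOn hsub).aestronglyMeasurable
    hball).smul ((hsub.norm.aemeasurable hball).inv.aestronglyMeasurable.smul
      (hP'.aestronglyMeasurable hball))).congr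
    (ae_of_all _ fun x => (curvatureIntegrand_comp_eq ε x).symm)

lemma eventually_integrable_curvatureIntegrand_and_norm_sub_le (h : IsLocalGraph M a φ)
    (hw : IsRadialProfile (derivWithin ρ (Ici 0)))
    (hP : HasQuadraticExpansion (fun x => P (φ x) (φ x - a)) ℓ b) :
    ∃ K, ∀ c > 0, ∀ᶠ ε in 𝓝[>] 0,
      Integrable (curvatureIntegrand ρ P a ε)
        (weightMeasure (Module.finrank ℝ (tanSpace M a)) M) ∧
      ‖∫ y, curvatureIntegrand ρ P a ε y ∂weightMeasure (Module.finrank ℝ (tanSpace M a)) M -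
          ∫ x, modelIntegrand (derivWithin ρ (Ici 0)) ℓ b ε x‖ ≤
        c * K * ε ^ (Module.finrank ℝ (tanSpace M a) + 1) := by
  obtain ⟨A, hA₀, hA⟩ := exists_norm_modelIntegrand_le hw ℓ b
  obtain ⟨C, hC⟩ := h.exists_eventually_norm_sub_le
  have hpos : ∀ᶠ ε : ℝ in 𝓝[>] 0, 0 < ε := self_mem_nhdsWithin
  have hle_one : ∀ᶠ ε : ℝ in 𝓝[>] 0, ε ≤ 1 := nhdsWithin_le_nhds (ge_mem_nhds one_pos)
  refine ⟨(2 + A) * volume.real (Metric.ball (0 : tanSpace M a) 1), fun c hc => ?_⟩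
  have hclose := h.eventually_integrable_and_norm_integral_sub_le (c := c)
    (F := curvatureIntegrand ρ P a) (g := modelIntegrand (derivWithin ρ (Ici 0)) ℓ b) hA₀ hc ?_
    (h.eventually_aestronglyMeasurable_curvatureIntegrand hw hP) ?_ ?_ ?_
  · filter_upwards [hclose, hpos] with ε hε hεpos
    rwa [setIntegral_eq_integral_of_forall_compl_eq_zero fun x hx =>
      modelIntegrand_eq_zero hw hεpos (by simpa using hx)] at hε
  · filter_upwards [hpos] with ε hε y hy
    rw [curvatureIntegrand, hw.comp_norm_div_eq_zero hε (by simpa [dist_eq_norm] using hy),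
      zero_smul]
  · filter_upwards [hpos] with ε hε using aestronglyMeasurable_modelIntegrand hw hε.le
  · filter_upwards [hpos, hle_one] with ε hε hε₁ x hx
    exact hA ε hε.le x ((mem_closedBall_zero_iff.1 hx).trans hε₁)
  · simpa only [curvatureIntegrand_comp_eq] using
      hP.eventually_norm_sub_modelIntegrand_le hw hC hc

lemma eventually_integrable_curvatureIntegrand (h : IsLocalGraph M a φ)
    (hρ : ContDiffOn ℝ 2 ρ (Ici 0)) (hρ₁ : ∀ t, 1 < t → ρ t = 0)
    (hP : HasQuadraticExpansion (fun x => P (φ x) (φ x - a)) ℓ b) :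
    ∀ᶠ ε in 𝓝[>] 0, Integrable (curvatureIntegrand ρ P a ε)
      (weightMeasure (Module.finrank ℝ (tanSpace M a)) M) := by
  obtain ⟨K, hK⟩ := h.eventually_integrable_curvatureIntegrand_and_norm_sub_le
    (isRadialProfile_derivWithin hρ hρ₁) hP
  exact (hK 1 one_pos).mono fun _ => And.left

lemma tendsto_integral_curvatureIntegrand (h : IsLocalGraph M a φ) [Nontrivial (tanSpace M a)]
    (hρ : ContDiffOn ℝ 2 ρ (Ici 0)) (hρ₁ : ∀ t, 1 < t → ρ t = 0)
    (hP : HasQuadraticExpansion (fun x => P (φ x) (φ x - a)) ℓ b) {ι : Type*} [Fintype ι]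
    (e : OrthonormalBasis ι ℝ (tanSpace M a)) :
    Tendsto (fun ε => (ε ^ (Module.finrank ℝ (tanSpace M a) + 1))⁻¹ •
        ∫ y, curvatureIntegrand ρ P a ε y ∂weightMeasure (Module.finrank ℝ (tanSpace M a)) M)
      (𝓝[>] 0) (𝓝 (-kernelConst (Module.finrank ℝ (tanSpace M a)) ρ • ∑ i, b (e i) (e i))) := by
  obtain ⟨K, hK⟩ := h.eventually_integrable_curvatureIntegrand_and_norm_sub_le
    (isRadialProfile_derivWithin hρ hρ₁) hP
  refine tendsto_inv_smul_of_isLittleO (eventually_mem_nhdsWithin.mono fun ε hε =>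
    pow_ne_zero _ (ne_of_gt hε)) (isLittleO_of_forall_norm_le K fun c hc => ?_)
  filter_upwards [hK c hc, self_mem_nhdsWithin] with ε hε hεpos
  rw [smul_smul, ← integral_modelIntegrand_derivWithin hρ hρ₁ hεpos e]
  exact hε.2

lemma tendsto_approxMeanCurvature (h : IsLocalGraph M a φ) (hρ : ContDiffOn ℝ 2 ρ (Ici 0))
    (hρ₁ : ∀ t, 1 < t → ρ t = 0) {ξ : ℝ → ℝ} (hξ : IsRadialProfile ξ)
    (hCρ : kernelConst (Module.finrank ℝ (tanSpace M a)) ρ ≠ 0)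
    (hCξ : kernelConst (Module.finrank ℝ (tanSpace M a)) ξ ≠ 0) [Nontrivial (tanSpace M a)]
    (hP : HasQuadraticExpansion (fun x => P (φ x) (φ x - a)) ℓ b) {ι : Type*} [Fintype ι]
    (e : OrthonormalBasis ι ℝ (tanSpace M a)) :
    Tendsto (approxMeanCurvature (Module.finrank ℝ (tanSpace M a)) ρ ξ
      (weightMeasure (Module.finrank ℝ (tanSpace M a)) M) P a) (𝓝[>] 0)
      (𝓝 (∑ i, b (e i) (e i))) := by
  set m := Module.finrank ℝ (tanSpace M a)
  have hlim := ((tendsto_const_nhds (x := -(kernelConst m ξ / kernelConst m ρ))).mul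
    ((h.tendsto_mollifiedMass hξ).inv₀ hCξ)).smul
      (h.tendsto_integral_curvatureIntegrand hρ hρ₁ hP e)
  have hcancel : (-(kernelConst m ξ / kernelConst m ρ) * (kernelConst m ξ)⁻¹) •
      -kernelConst m ρ • ∑ i, b (e i) (e i) = ∑ i, b (e i) (e i) := by
    rw [smul_smul]
    convert one_smul ℝ _
    field_simp
  rw [hcancel] at hlim
  refine hlim.congr fun ε => ?_
  rw [approxMeanCurvature, smul_smul, smul_smul]
  congr 1
  rw [pow_succ, mul_inv, mul_inv, div_mul_eq_div_div, div_eq_mul_inv _ ε]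
  ring

end Curvature

end IsLocalGraph

end Graph

theorem proposition2p2_general {n d : ℕ} {M : Set (EuclideanSpace ℝ (Fin n))}
    {a : EuclideanSpace ℝ (Fin n)} (hM : IsC2SubmanifoldAt d M a) {ρ ξ : ℝ → ℝ}
    (hρ : ContDiffOn ℝ 2 ρ (Ici 0)) (hρ₁ : ∀ t, 1 < t → ρ t = 0) (hCρ : kernelConst d ρ ≠ 0)
    (hξ : IsRadialProfile ξ) (hCξ : 0 < kernelConst d ξ) :
    (∀ᶠ ε in 𝓝[>] (0 : ℝ), 0 < mollifiedMass d ξ (weightMeasure d M) a ε) ∧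
    (∀ P ∈ ({fun y => (2 : ℝ) • (norProj M y ∘L norProj M a),
             fun y => tanProj M y ∘L tanProj M a,
             fun y => -(norProj M y ∘L tanProj M a)} :
          Set (EuclideanSpace ℝ (Fin n) →
            EuclideanSpace ℝ (Fin n) →L[ℝ] EuclideanSpace ℝ (Fin n))),
        (∀ᶠ ε in 𝓝[>] (0 : ℝ), Integrable (curvatureIntegrand ρ P a ε) (weightMeasure d M)) ∧
        Tendsto (fun ε => approxMeanCurvature d ρ ξ (weightMeasure d M) P a ε)
          (𝓝[>] 0) (𝓝 (meanCurvature M a))) ∧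
    (∀ P ∈ ({fun _ => tanProj M a,
             fun y => tanProj M a ∘L tanProj M y,
             fun y => tanProj M y ∘L norProj M a,
             fun y => tanProj M a ∘L norProj M y} :
          Set (EuclideanSpace ℝ (Fin n) →
            EuclideanSpace ℝ (Fin n) →L[ℝ] EuclideanSpace ℝ (Fin n))),
        (∀ᶠ ε in 𝓝[>] (0 : ℝ), Integrable (curvatureIntegrand ρ P a ε) (weightMeasure d M)) ∧
        Tendsto (fun ε => approxMeanCurvature d ρ ξ (weightMeasure d M) P a ε)
          (𝓝[>] 0) (𝓝 0)) := by
  obtain rfl := hM.finrank_tanSpace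
  have : Nontrivial (tanSpace M a) := Module.nontrivial_of_finrank_pos (R := ℝ)
    (Nat.pos_of_ne_zero fun hd => hCξ.ne' (by simp only [kernelConst, hd, Nat.cast_zero, zero_mul]))
  obtain ⟨φ, hφ⟩ := hM.exists_isLocalGraph
  have hlimit {P : EuclideanSpace ℝ (Fin n) → EuclideanSpace ℝ (Fin n) →L[ℝ]
      EuclideanSpace ℝ (Fin n)} {ℓ b H}
      (hP : HasQuadraticExpansion (fun x => P (φ x) (φ x - a)) ℓ b)
      (hH : ∑ i, b (stdOrthonormalBasis ℝ _ i) (stdOrthonormalBasis ℝ _ i) = H) :=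
    And.intro (hφ.eventually_integrable_curvatureIntegrand hρ hρ₁ hP)
      (hH ▸ hφ.tendsto_approxMeanCurvature hρ hρ₁ hξ hCρ hCξ.ne' hP _)
  have htrace := hφ.meanCurvature_eq_trace_hessian.symm
  refine ⟨(hφ.tendsto_mollifiedMass hξ).eventually (lt_mem_nhds hCξ), ?_, ?_⟩
  · rintro P (rfl | rfl | rfl)
    exacts [hlimit hφ.hasQuadraticExpansion_norProj_norProj htrace,
      hlimit hφ.hasQuadraticExpansion_moving_base htrace,
      hlimit hφ.hasQuadraticExpansion_neg_norProj_tanProj htrace]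
  · rintro P (rfl | rfl | rfl | rfl)
    exacts [hlimit hφ.hasQuadraticExpansion_base (by simp),
      hlimit hφ.hasQuadraticExpansion_base_moving (by simp),
      hlimit hφ.hasQuadraticExpansion_tanProj_norProj (by simp),
      hlimit hφ.hasQuadraticExpansion_base_norProj (by simp)]

theorem proposition2p2 {n d : ℕ} (hd : 1 ≤ d) (M : Set (EuclideanSpace ℝ (Fin n)))
    (hM : IsC2Submanifold d M) (h0 : (0 : EuclideanSpace ℝ (Fin n)) ∈ M)
    (ρ ξ : ℝ → ℝ) (hρ : IsKernel ρ) (hξ : IsKernel ξ) :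
    (∀ᶠ ε in 𝓝[>] (0 : ℝ), 0 < mollifiedMass d ξ (weightMeasure d M) 0 ε) ∧
    (∀ P ∈ ({fun y => (2 : ℝ) • (norProj M y ∘L norProj M 0),
             fun y => tanProj M y ∘L tanProj M 0,
             fun y => -(norProj M y ∘L tanProj M 0)} :
          Set (EuclideanSpace ℝ (Fin n) →
            EuclideanSpace ℝ (Fin n) →L[ℝ] EuclideanSpace ℝ (Fin n))),
        (∀ᶠ ε in 𝓝[>] (0 : ℝ), Integrable (curvatureIntegrand ρ P 0 ε) (weightMeasure d M)) ∧
        Tendsto (fun ε => approxMeanCurvature d ρ ξ (weightMeasure d M) P 0 ε)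
          (𝓝[>] 0) (𝓝 (meanCurvature M 0))) ∧
    (∀ P ∈ ({fun _ => tanProj M 0,
             fun y => tanProj M 0 ∘L tanProj M y,
             fun y => tanProj M y ∘L norProj M 0,
             fun y => tanProj M 0 ∘L norProj M y} :
          Set (EuclideanSpace ℝ (Fin n) →
            EuclideanSpace ℝ (Fin n) →L[ℝ] EuclideanSpace ℝ (Fin n))),
        (∀ᶠ ε in 𝓝[>] (0 : ℝ), Integrable (curvatureIntegrand ρ P 0 ε) (weightMeasure d M)) ∧
        Tendsto (fun ε => approxMeanCurvature d ρ ξ (weightMeasure d M) P 0 ε)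
          (𝓝[>] 0) (𝓝 0)) := by
  have hpos {w : ℝ → ℝ} (hw : IsKernel w) : 0 < kernelConst d w :=
    kernelConst_pos hd hw.smooth.continuousOn hw.nonneg hw.supported hw.nontrivial
  exact proposition2p2_general ⟨h0, hM 0 h0⟩ (contDiffOn_infty.1 hρ.smooth 2) hρ.supported
    (hpos hρ).ne' (isRadialProfile_of_contDiffOn (contDiffOn_infty.1 hξ.smooth 1) hξ.supported)
    (hpos hξ)
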